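/- Let $d\ge 3$. There exists no symmetric, maximally nontrivial $\psi$-epistemic theory in dimension $d$. Here an \emph{ontological theory} in dimension $d$ with ontic space a measurable space $\Lambda$ consists of a probability measure $\mu_\psi$ on $\Lambda$ for every unit vector $\psi\in\mathbb C^d$ and, for every orthonormal basis $M=(\phi_1,\dots,\phi_d)$ of $\mathbb C^d$, measurable response functions $\xi_{1,M},\dots,\xi_{d,M}:\Lambda\to[0,1]$, such that $$\int_\Lambda \xi_{k,M}\,d\mu_\psi=|\langle\phi_k|\psi\rangle|^2\quad\text{for all } k,M,\psi,\qquad \sum_{k=1}^d\xi_{k,M}(\lambda)=1\quad\text{for all }\lambda,M .$$ Two states $\psi,\phi$ have \emph{nontrivial overlap} if the total variation distance $\tfrac12|\mu_\psi-\mu_\phi|(\Lambda)$ is less than $1$. The theory is \emph{$\psi$-epistemic} if some two distinct states (i.e. unit vectors not equal up to a phase) have nontrivial overlap, and \emph{maximally nontrivial} if any two non-orthogonal states have nontrivial overlap. It is \emph{symmetric} if $\Lambda=\mathbb{CP}^{d-1}$ (with its Borel $\sigma$-algebra) and, for every $\psi$, the measure $\mu_\psi$ is invariant under the action on $\mathbb{CP}^{d-1}$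 of every unitary $U$ with $U\psi=\psi$ (so that $\mu_\psi$ is determined by a distribution of $|\langle\psi|\lambda\rangle|^2$, which may differ from state to state). The measures $\mu_\psi$ are not assumed to be absolutely continuous. -/

import Mathlib

open MeasureTheory
open scoped LinearAlgebra.Projectivization ENNReal

namespace PsiEpistemic

/-- The `d`-dimensional complex Hilbert space `H_d`. -/
abbrev Hilb (d : ℕ) : Type := EuclideanSpace ℂ (Fin d)

/-- Quantum states, as unit vectors of `H_d`. The distribution assigned to a state is not required
to be independent of the phase of the vector, which only enlarges the class of theories. -/
abbrev State (d : ℕ) : Type := Metric.sphere (0 : Hilb d) 1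

/-- The complex projective space `ℂP^{d-1}` of lines of `H_d`. -/
abbrev CP (d : ℕ) : Type := ℙ ℂ (Hilb d)

/-- The quotient topology of `H_d \ {0}`. -/
instance instTopologicalSpaceCP (d : ℕ) : TopologicalSpace (CP d) :=
  inferInstanceAs (TopologicalSpace (Quotient (projectivizationSetoid ℂ (Hilb d))))

instance instMeasurableSpaceCP (d : ℕ) : MeasurableSpace (CP d) := borel (CP d)

instance instBorelSpaceCP (d : ℕ) : BorelSpace (CP d) := ⟨rfl⟩

/-- The point of `ℂP^{d-1}` that is represented by a unit vector. -/
noncomputable def State.ray {d : ℕ} (ψ : State d) : CP d :=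
  Projectivization.mk ℂ (ψ : Hilb d) (ne_zero_of_mem_unit_sphere ψ)

/-- The action of a unitary transformation of `H_d` on `ℂP^{d-1}`. -/
noncomputable def unitaryAct {d : ℕ} (U : Hilb d ≃ₗᵢ[ℂ] Hilb d) : CP d → CP d :=
  Projectivization.map (U.toLinearEquiv : Hilb d →ₗ[ℂ] Hilb d) U.injective

theorem continuous_unitaryAct {d : ℕ} (U : Hilb d ≃ₗᵢ[ℂ] Hilb d) : Continuous (unitaryAct U) := by
  refine continuous_quot_lift _ ?_
  refine continuous_quotient_mk'.comp ?_
  exact Continuous.subtype_mk (U.continuous.comp continuous_subtype_val) _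

theorem measurable_unitaryAct {d : ℕ} (U : Hilb d ≃ₗᵢ[ℂ] Hilb d) : Measurable (unitaryAct U) :=
  (continuous_unitaryAct U).measurable

/-- The total variation distance `½ |P - Q|(Λ)` of two probability measures. -/
noncomputable def tvDist {Λ : Type*} [MeasurableSpace Λ] (P Q : ProbabilityMeasure Λ) : ℝ≥0∞ :=
  ((P : Measure Λ).toSignedMeasure - (Q : Measure Λ).toSignedMeasure).totalVariation Set.univ / 2

/-- An ontological theory in dimension `d` with ontic space `Λ`. -/
structure OntologicalTheory (d : ℕ) (Λ : Type*) [MeasurableSpace Λ] where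
  /-- The probability measure `μ_ψ` on the ontic space assigned to the state `ψ`. -/
  μ : State d → ProbabilityMeasure Λ
  /-- The response functions: `ξ M k l` is the probability that the ontic state `l` produces the
  outcome `M k` when it is measured in the orthonormal basis `M`. -/
  ξ : OrthonormalBasis (Fin d) ℂ (Hilb d) → Fin d → Λ → ℝ
  measurable_ξ : ∀ M k, Measurable (ξ M k)
  ξ_mem_Icc : ∀ M k l, ξ M k l ∈ Set.Icc (0 : ℝ) 1
  /-- The Born rule. -/
  born : ∀ M k ψ, ∫ l, ξ M k l ∂(μ ψ : Measure Λ) = ‖inner ℂ (M k) (ψ : Hilb d)‖ ^ 2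
  /-- Every ontic state produces some outcome. -/
  sum_ξ : ∀ M l, ∑ k, ξ M k l = 1

namespace OntologicalTheory

variable {d : ℕ} {Λ : Type*} [MeasurableSpace Λ]

/-- The states `ψ` and `φ` have nontrivial overlap. -/
def NontrivialOverlap (T : OntologicalTheory d Λ) (ψ φ : State d) : Prop :=
  tvDist (T.μ ψ) (T.μ φ) < 1

/-- Some two different states (vectors that differ by a phase are the same state) have nontrivial
overlap. -/
def IsPsiEpistemic (T : OntologicalTheory d Λ) : Prop :=
  ∃ ψ φ : State d, ψ.ray ≠ φ.ray ∧ T.NontrivialOverlap ψ φ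

/-- Any two non-orthogonal states have nontrivial overlap. -/
def IsMaximallyNontrivial (T : OntologicalTheory d Λ) : Prop :=
  ∀ ψ φ : State d, inner ℂ (ψ : Hilb d) (φ : Hilb d) ≠ 0 → T.NontrivialOverlap ψ φ

/-- The ontic space is `ℂP^{d-1}` and each `μ_ψ` is invariant under the unitary transformations
that fix `ψ`. -/
def IsSymmetric (T : OntologicalTheory d (CP d)) : Prop :=
  ∀ (ψ : State d) (U : Hilb d ≃ₗᵢ[ℂ] Hilb d), U (ψ : Hilb d) = (ψ : Hilb d) →
    MeasurePreserving (unitaryAct U) (T.μ ψ : Measure (CP d)) (T.μ ψ : Measure (CP d))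

end OntologicalTheory

end PsiEpistemic

open Filter Topology Metric Set

namespace PsiEpistemic

variable {d : ℕ}

/-! ### Null sets under analytic functions and under submersions. -/

section Analysis

/-! By symmetry, `μ_ψ` is governed by the distribution of the overlap `|⟨ψ|λ⟩|²`, a measure on
`[0,1]`. Lebesgue decomposition splits it into a singular part carried by a null set `N` and an
absolutely continuous part carried by a set `S ⊆ (0,1)`, chosen so that `S` has positive measure
near each of its points. A contradiction comes from locating `S`.

The singular parts contribute no overlap. Unitaries fixing `φ` spread `λ ≠ φ` so much, when `d ≥ 3`,
that under `μ_φ` the overlap with another state `ψ` has an absolutely continuous law away from the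
point `φ` (`measure_overlap_sdiff_eq_zero`). Hence nontrivial overlap of `ψ ≠ φ` forces a line whose
overlaps with `ψ` and `φ` lie in both sets `S` (`NontrivialOverlap.exists_overlap_mem`).

On the absolutely continuous parts, `μ_ψ`-null sets are null for the unitarily invariant measure
class (`coneMeasure_inter_eq_zero`). If every outcome of a basis is impossible for one of the states
`χ i`, the response functions, which sum to one, all vanish almost everywhere on the lines with
overlaps in every `S i`; these lines therefore form a null set
(`coneMeasure_iInter_eq_zero_of_orthogonal`). But they have positive measure as soon as the overlaps
form a submersion at a point whose values are approached by the sets `S i` in positive measure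
(`coneMeasure_iInter_overlap_ne_zero`).

Playing these off for two orthogonal states gives `s + t ≥ 1` for `s ∈ S`, `t ∈ S'`. Maximal
nontriviality for almost orthogonal states, with the triangle inequality for angles, then gives `S ⊆
[1/2, 1)` and makes `S` accumulate at `1/2` for every state. Finally, three states excluded one by
one by a basis, all at overlap `1/2` with one vector and with independent gradients there
(`exists_triple`), give the contradiction. -/

theorem volume_preimage_inter_deriv_ne_zero {f : ℝ → ℝ} (hf : AnalyticOnNhd ℝ f univ) {N : Set ℝ}
    (hN : volume N = 0) : volume (f ⁻¹' N ∩ {x | deriv f x ≠ 0}) = 0 := by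
  refine measure_null_of_locally_null _ fun x hx => ?_
  have hs : HasStrictDerivAt f (deriv f x) x := (hf x (mem_univ x)).hasStrictDerivAt
  let e := (hs.hasStrictFDerivAt_equiv hx.2).toOpenPartialHomeomorph f
  have hxe : x ∈ e.source := HasStrictFDerivAt.mem_toOpenPartialHomeomorph_source _
  refine ⟨(f ⁻¹' N ∩ {x | deriv f x ≠ 0}) ∩ e.source,
    inter_mem self_mem_nhdsWithin (mem_nhdsWithin_of_mem_nhds (e.open_source.mem_nhds hxe)), ?_⟩
  set W := (f ⁻¹' N ∩ {x | deriv f x ≠ 0}) ∩ e.source with hW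
  -- Near a point with nonzero derivative, the preimage is the image of part of `N` under a
  -- differentiable local inverse, and differentiable maps preserve null sets.
  have hW' : W ⊆ e.symm '' (f '' W) := by
    intro w hw
    exact ⟨f w, ⟨w, hw, rfl⟩, e.left_inv hw.2⟩
  refine measure_mono_null hW' ?_
  refine addHaar_image_eq_zero_of_differentiableOn_of_addHaar_eq_zero _ ?_ ?_
  · rintro _ ⟨w, hw, rfl⟩
    have hsw : HasStrictDerivAt f (deriv f w) w := (hf w (mem_univ w)).hasStrictDerivAt
    have hl : e.symm (f w) = w := e.left_inv hw.2
    have hd : HasDerivAt e (deriv f w) (e.symm (f w)) := by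
      rw [hl]; exact hsw.hasDerivAt
    exact (e.hasDerivAt_symm (e.map_source hw.2) hw.1.2 hd).differentiableAt.differentiableWithinAt
  · refine measure_mono_null ?_ hN
    rintro _ ⟨w, hw, rfl⟩
    exact hw.1.1

/-- The preimage of a null set under a nonconstant real analytic function is a null set. -/
theorem volume_preimage_eq_zero_of_analytic {f : ℝ → ℝ} (hf : AnalyticOnNhd ℝ f univ) {x y : ℝ}
    (hxy : f x ≠ f y) {N : Set ℝ} (hN : volume N = 0) : volume (f ⁻¹' N) = 0 := by
  have hd : AnalyticOnNhd ℝ (deriv f) univ := hf.deriv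
  obtain ⟨z, hz⟩ : ∃ z, deriv f z ≠ 0 := by
    by_contra! h
    exact hxy (is_const_of_deriv_eq_zero (fun z => (hf z (mem_univ z)).differentiableAt) h x y)
  have hc : (deriv f ⁻¹' {0}ᶜ) ∈ codiscreteWithin (univ : Set ℝ) :=
    hd.preimage_zero_mem_codiscrete hz
  have hae : ∀ᵐ t : ℝ, deriv f t ≠ 0 := by
    have := ae_restrict_le_codiscreteWithin (μ := (volume : Measure ℝ)) MeasurableSet.univ hc
    rw [Measure.restrict_univ] at this
    exact this
  refine measure_mono_null (t := (f ⁻¹' N ∩ {x | deriv f x ≠ 0}) ∪ {x | ¬ deriv f x ≠ 0}) ?_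
    (measure_union_null (volume_preimage_inter_deriv_ne_zero hf hN) hae)
  intro t ht
  by_cases h : deriv f t ≠ 0
  · exact Or.inl ⟨ht, h⟩
  · exact Or.inr h

variable {E F : Type*} [NormedAddCommGroup E] [NormedSpace ℝ E] [FiniteDimensional ℝ E]
  [MeasurableSpace E] [BorelSpace E] [NormedAddCommGroup F] [NormedSpace ℝ F]
  [FiniteDimensional ℝ F] [MeasurableSpace F] [BorelSpace F]

/-- The preimage under a local submersion of a set that is nowhere null near the value has
positive measure. -/
theorem measure_preimage_ne_zero_of_surjective (μ : Measure E) [μ.IsAddHaarMeasure] (ν : Measure F)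
    [ν.IsAddHaarMeasure] {f : E → F} {L : E →L[ℝ] F} {v : E} (hf : ContDiffAt ℝ 1 f v)
    (hL : HasFDerivAt f L v) (hsurj : Function.Surjective L) {T : Set F}
    (hT : ∀ ε > 0, ν (T ∩ ball (f v) ε) ≠ 0) (hm : MeasurableSet (f ⁻¹' T)) :
    μ (f ⁻¹' T) ≠ 0 := by
  intro h0
  obtain ⟨R₀, hR₀⟩ := (L : E →ₗ[ℝ] F).exists_rightInverse_of_surjective
    (LinearMap.range_eq_top.2 hsurj)
  let R : F →L[ℝ] E := LinearMap.toContinuousLinearMap R₀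
  have hLR : ∀ w, L (R w) = w := fun w => LinearMap.congr_fun hR₀ w
  have hstrict : HasStrictFDerivAt f L v := hf.hasStrictFDerivAt' hL one_ne_zero
  -- With this constant, `w ↦ f (y + R w)` differs from the identity by a map of Lipschitz constant
  -- at most `1/2`, so it sends the ball of radius `ρ` onto a set containing the ball of radius `ρ /
  -- 2` around `f y`. The radius `ρ / 4` below leaves room for moving from `f v` to `f y`.
  set c : NNReal := (2 * (‖R‖₊ + 1))⁻¹ with hc
  have hc0 : 0 < c := by positivity
  have hcR : c * ‖R‖₊ ≤ 2⁻¹ := by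
    rw [hc, mul_inv, mul_assoc]
    refine mul_le_of_le_one_right (by positivity) ?_
    rw [inv_mul_le_iff₀ (by positivity)]
    simp
  obtain ⟨U, hU, hUa⟩ := hstrict.approximates_deriv_on_nhds (Or.inr hc0)
  have hdiff : ∀ᶠ z in 𝓝 v, DifferentiableAt ℝ f z := by
    filter_upwards [hf.eventually (by simp)] with z hz using hz.differentiableAt one_ne_zero
  obtain ⟨δ, hδ, hball⟩ := Metric.mem_nhds_iff.1 (inter_mem hU hdiff)
  set ρ : ℝ := δ / (4 * (‖R‖ + 1)) with hρ
  have hρ0 : 0 < ρ := by positivity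
  have hRρ : ‖R‖ * ρ < δ / 2 := by
    rw [hρ, mul_div_assoc', div_lt_div_iff₀ (by positivity) (by positivity)]
    nlinarith [norm_nonneg R]
  have hnear : ∀ᶠ y in 𝓝 v, dist (f y) (f v) < ρ / 4 :=
    hf.continuousAt.eventually (ball_mem_nhds _ (by positivity))
  obtain ⟨δ', hδ', hball'⟩ := Metric.mem_nhds_iff.1 hnear
  -- Fubini along the range of the right inverse `R`: a null preimage meets almost every slice `y +
  -- R w` in a null set, and some such slice passes close to `v`.
  have hae : ∀ᵐ y ∂μ, ∀ᵐ w ∂ν, y + R w ∈ (f ⁻¹' T)ᶜ :=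
    (ae_ae_add_linearMap_mem_iff (R : F →ₗ[ℝ] E) ν μ hm.compl).2
      (measure_eq_zero_iff_ae_notMem.1 h0)
  obtain ⟨y, hy, hyae⟩ : ∃ y ∈ ball v (min δ' (δ / 2)), ∀ᵐ w ∂ν, y + R w ∈ (f ⁻¹' T)ᶜ := by
    by_contra hcon
    have : μ (ball v (min δ' (δ / 2))) = 0 := measure_eq_zero_iff_ae_notMem.2
      (hae.mono fun y hy hyb => hcon ⟨y, hyb, hy⟩)
    exact (measure_ball_pos μ v (lt_min hδ' (half_pos hδ))).ne' this
  have hyδ : ∀ w ∈ closedBall (0 : F) ρ, y + R w ∈ ball v δ := by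
    intro w hw
    have h1 : dist y v < δ / 2 := lt_of_lt_of_le hy (min_le_right _ _)
    have h2 : ‖R w‖ ≤ ‖R‖ * ρ := (R.le_opNorm w).trans
      (mul_le_mul_of_nonneg_left (by simpa using hw) (norm_nonneg _))
    rw [mem_ball, dist_eq_norm] at *
    calc ‖y + R w - v‖ = ‖(y - v) + R w‖ := by congr 1; abel
      _ ≤ ‖y - v‖ + ‖R w‖ := norm_add_le _ _
      _ < δ := by linarith
  have happ : ApproximatesLinearOn (fun w => f (y + R w)) (ContinuousLinearMap.id ℝ F)
      (closedBall 0 ρ) (c * ‖R‖₊) := by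
    intro a ha b hb
    have := hUa _ (hball (hyδ a ha)).1 _ (hball (hyδ b hb)).1
    have e : y + R a - (y + R b) = R (a - b) := by rw [map_sub]; abel
    rw [e, hLR] at this
    refine this.trans ?_
    rw [NNReal.coe_mul, mul_assoc]
    exact mul_le_mul_of_nonneg_left (R.le_opNorm _) c.2
  let inv : (ContinuousLinearMap.id ℝ F).NonlinearRightInverse :=
    { toFun := id, nnnorm := 1, bound' := by simp, right_inv' := fun _ => rfl }
  have hsurjOn := happ.surjOn_closedBall_of_nonlinearRightInverse inv (b := 0) hρ0.le subset_rfl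
  have hcR' : (c * ‖R‖₊ : NNReal) ≤ (2⁻¹ : ℝ) := by exact_mod_cast hcR
  have hsub : T ∩ ball (f v) (ρ / 4) ⊆
      (fun w => f (y + R w)) '' (closedBall 0 ρ ∩ {w | y + R w ∈ f ⁻¹' T}) := by
    rintro t ⟨htT, ht⟩
    have : t ∈ closedBall ((fun w => f (y + R w)) 0)
        ((((inv.nnnorm : NNReal) : ℝ)⁻¹ - (c * ‖R‖₊ : NNReal)) * ρ) := by
      have h3 : dist (f y) (f v) < ρ / 4 := hball' (ball_subset_ball (min_le_left _ _) hy)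
      have h4 : dist t (f y) < ρ / 2 := by
        have := dist_triangle_right t (f y) (f v)
        rw [mem_ball] at ht
        linarith
      rw [mem_closedBall]
      simp only [map_zero, add_zero]
      refine h4.le.trans ?_
      have : (((inv.nnnorm : NNReal) : ℝ)⁻¹) = 1 := by simp [inv]
      rw [this]
      nlinarith
    obtain ⟨w, hw, hwt⟩ := hsurjOn this
    refine ⟨w, ⟨hw, ?_⟩, hwt⟩
    change f (y + R w) ∈ T
    have : f (y + R w) = t := hwt
    rwa [this]
  refine hT (ρ / 4) (by positivity) (measure_mono_null hsub ?_)
  refine addHaar_image_eq_zero_of_differentiableOn_of_addHaar_eq_zero _ ?_ ?_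
  · rintro w ⟨hw, -⟩
    refine DifferentiableAt.differentiableWithinAt ?_
    have h1 : DifferentiableAt ℝ f (y + R w) := (hball (hyδ w hw)).2
    exact h1.comp w ((differentiableAt_const y).add R.differentiableAt)
  · refine measure_mono_null inter_subset_right ?_
    rw [ae_iff] at hyae
    simpa using hyae

end Analysis

/-! ### The quotient topology of projective space. -/

section Topology

/-- The saturation of an open set is the union of its scalar multiples. Openness matters because
products of open quotient maps are quotient maps, so joint continuity of an action can be checked on
vectors. -/
theorem isOpenQuotientMap_mk' :
    IsOpenQuotientMap (Projectivization.mk' ℂ : {v : Hilb d // v ≠ 0} → CP d) := by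
  refine ⟨Quotient.mk''_surjective, continuous_quotient_mk', fun U hU => ?_⟩
  have hq : IsOpen ((Projectivization.mk' ℂ : {v : Hilb d // v ≠ 0} → CP d) ⁻¹'
      (Projectivization.mk' ℂ '' U)) := by
    have e : (Projectivization.mk' ℂ : {v : Hilb d // v ≠ 0} → CP d) ⁻¹'
        (Projectivization.mk' ℂ '' U) =
        ⋃ c : ℂˣ, (fun v : {v : Hilb d // v ≠ 0} =>
          (⟨c • (v : Hilb d), smul_ne_zero c.ne_zero v.2⟩ :
            {v : Hilb d // v ≠ 0})) ⁻¹' U := by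
      ext v
      simp only [mem_preimage, mem_image, mem_iUnion]
      constructor
      · rintro ⟨w, hw, hwv⟩
        obtain ⟨c, hc⟩ := (Projectivization.mk_eq_mk_iff ℂ (w : Hilb d) v w.2 v.2).1 hwv
        exact ⟨c, by convert hw⟩
      · rintro ⟨c, hc⟩
        exact ⟨_, hc, (Projectivization.mk_eq_mk_iff ℂ _ _ _ _).2 ⟨c, rfl⟩⟩
    rw [e]
    refine isOpen_iUnion fun c => hU.preimage ?_
    exact Continuous.subtype_mk (continuous_subtype_val.const_smul (c : ℂ)) _
  exact hq

theorem continuous_mk' : Continuous (Projectivization.mk' ℂ : {v : Hilb d // v ≠ 0} → CP d) :=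
  isOpenQuotientMap_mk'.continuous

theorem unitaryAct_mk (U : Hilb d ≃ₗᵢ[ℂ] Hilb d) (v : Hilb d) (hv : v ≠ 0) :
    unitaryAct U (Projectivization.mk ℂ v hv) =
      Projectivization.mk ℂ (U v) ((map_ne_zero_iff U U.injective).2 hv) := rfl

theorem continuous_unitaryAct_uncurry {X : Type*} [TopologicalSpace X]
    {g : X → Hilb d ≃ₗᵢ[ℂ] Hilb d} (hg : Continuous fun p : X × Hilb d => g p.1 p.2) :
    Continuous fun p : X × CP d => unitaryAct (g p.1) p.2 := by
  have hq := (IsOpenQuotientMap.id (X := X)).prodMap (isOpenQuotientMap_mk' (d := d))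
  rw [← hq.continuous_comp_iff]
  refine continuous_mk'.comp (f := fun p : X × {v : Hilb d // v ≠ 0} =>
    (⟨g p.1 p.2, (map_ne_zero_iff _ (g p.1).injective).2 p.2.2⟩ : {v : Hilb d // v ≠ 0})) ?_
  exact Continuous.subtype_mk
    (hg.comp (continuous_fst.prodMk (continuous_subtype_val.comp continuous_snd))) _

end Topology

/-! ### The overlap of a vector with a line. -/

section Overlap

/-- The squared modulus of the inner product of `x` with the normalization of `v`. -/
noncomputable def vecOverlap (x v : Hilb d) : ℝ := ‖inner ℂ x v‖ ^ 2 / ‖v‖ ^ 2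

theorem vecOverlap_smul (x v : Hilb d) {c : ℂ} (hc : c ≠ 0) :
    vecOverlap x (c • v) = vecOverlap x v := by
  have : ‖c‖ ^ 2 ≠ 0 := by simpa using hc
  rw [vecOverlap, vecOverlap, inner_smul_right, norm_mul, norm_smul, mul_pow, mul_pow,
    mul_div_mul_left _ _ this]

theorem measurable_vecOverlap (x : Hilb d) : Measurable (vecOverlap x) := by
  unfold vecOverlap
  exact ((continuous_const.inner continuous_id).norm.pow 2).measurable.div
    (continuous_norm.pow 2).measurable

theorem vecOverlap_map (U : Hilb d ≃ₗᵢ[ℂ] Hilb d) (x v : Hilb d) :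
    vecOverlap (U x) (U v) = vecOverlap x v := by
  simp [vecOverlap]

theorem vecOverlap_mem_Icc (ψ : State d) (v : Hilb d) : vecOverlap ψ v ∈ Icc (0 : ℝ) 1 := by
  refine ⟨by unfold vecOverlap; positivity, div_le_one_of_le₀ ?_ (by positivity)⟩
  have h := norm_inner_le_norm (𝕜 := ℂ) (ψ : Hilb d) v
  rw [norm_eq_of_mem_sphere, one_mul] at h
  gcongr

/-- The squared modulus of the inner product of `x` with a unit vector on the line `l`. -/
noncomputable def overlap (x : Hilb d) (l : CP d) : ℝ := vecOverlap x l.rep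

theorem overlap_mk (x v : Hilb d) (hv : v ≠ 0) :
    overlap x (Projectivization.mk ℂ v hv) = vecOverlap x v := by
  obtain ⟨a, ha⟩ := Projectivization.exists_smul_eq_mk_rep ℂ v hv
  rw [overlap, ← ha]
  exact vecOverlap_smul x v a.ne_zero

theorem continuous_overlap (x : Hilb d) : Continuous (overlap x) := by
  rw [← (isOpenQuotientMap_mk' (d := d)).continuous_comp_iff]
  have : overlap x ∘ Projectivization.mk' ℂ = fun v : {v : Hilb d // v ≠ 0} => vecOverlap x v := by
    ext v
    exact overlap_mk x v v.2
  rw [this]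
  unfold vecOverlap
  refine Continuous.div ?_ (by fun_prop) fun v => ?_
  · exact (continuous_const.inner continuous_subtype_val).norm.pow 2
  · have := v.2
    positivity

theorem measurable_overlap (x : Hilb d) : Measurable (overlap x) := (continuous_overlap x).measurable

theorem overlap_mem_Icc (ψ : State d) (l : CP d) : overlap ψ l ∈ Icc (0 : ℝ) 1 :=
  vecOverlap_mem_Icc ψ _

theorem overlap_unitaryAct (U : Hilb d ≃ₗᵢ[ℂ] Hilb d) {x : Hilb d} (hx : U x = x) (l : CP d) :
    overlap x (unitaryAct U l) = overlap x l := by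
  induction l using Projectivization.ind with
  | h v hv => rw [unitaryAct_mk, overlap_mk, overlap_mk, ← vecOverlap_map U x v, hx]

/-- This is the equality case of the Cauchy–Schwarz inequality. -/
theorem overlap_eq_one_iff (ψ : State d) (l : CP d) : overlap ψ l = 1 ↔ l = ψ.ray := by
  have hψ : ‖(ψ : Hilb d)‖ = 1 := norm_eq_of_mem_sphere ψ
  induction l using Projectivization.ind with
  | h v hv =>
    have hv' : ‖v‖ ≠ 0 := norm_ne_zero_iff.2 hv
    rw [overlap_mk, State.ray, vecOverlap, div_eq_one_iff_eq (by positivity),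
      pow_left_inj₀ (norm_nonneg _) (norm_nonneg _) two_ne_zero]
    have := norm_inner_eq_norm_iff (𝕜 := ℂ) (ne_zero_of_mem_unit_sphere ψ) hv
    rw [hψ, one_mul] at this
    rw [this, eq_comm (a := Projectivization.mk ℂ v hv)]
    constructor
    · rintro ⟨r, hr, h⟩
      rw [eq_comm]
      exact (Projectivization.mk_eq_mk_iff ℂ _ _ _ _).2 ⟨Units.mk0 r hr, h.symm⟩
    · intro h
      obtain ⟨a, ha⟩ := (Projectivization.mk_eq_mk_iff ℂ _ _ _ _).1 h.symm
      exact ⟨a, a.ne_zero, ha.symm⟩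

theorem measurableSet_singleton_ray (ψ : State d) : MeasurableSet ({ψ.ray} : Set (CP d)) := by
  have : ({ψ.ray} : Set (CP d)) = overlap ψ ⁻¹' {1} := by
    ext l
    simp [overlap_eq_one_iff]
  rw [this]
  exact measurable_overlap _ (measurableSet_singleton 1)

end Overlap

/-! ### The unitarily invariant measure class on projective space. -/

section ConeMeasure

/-- The push-forward of Lebesgue measure on `H_d \ {0}`, which is equivalent to the unitarily
invariant probability measure of `ℂP^{d-1}`. -/
noncomputable def coneMeasure (d : ℕ) : Measure (CP d) :=
  ((volume : Measure (Hilb d)).comap (Subtype.val : {v : Hilb d // v ≠ 0} → Hilb d)).map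
    (Projectivization.mk' ℂ)

theorem measurableEmbedding_val :
    MeasurableEmbedding (Subtype.val : {v : Hilb d // v ≠ 0} → Hilb d) :=
  MeasurableEmbedding.subtype_coe (measurableSet_singleton (0 : Hilb d)).compl

/-- Preimages of sets of lines are cones, so for `d ≥ 1` the only values are `0` and `∞`. Only null
sets matter here, and s-finiteness is enough for Fubini. -/
instance : SFinite (coneMeasure d) := by
  have : SigmaFinite
      ((volume : Measure (Hilb d)).comap (Subtype.val : {v : Hilb d // v ≠ 0} → Hilb d)) := by
    refine SigmaFinite.of_map _ measurable_subtype_coe.aemeasurable ?_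
    rw [measurableEmbedding_val.map_comap]
    infer_instance
  unfold coneMeasure
  infer_instance

theorem coneMeasure_apply {A : Set (CP d)} (hA : MeasurableSet A) :
    coneMeasure d A =
      volume {v : Hilb d | ∃ hv : v ≠ 0, Projectivization.mk ℂ v hv ∈ A} := by
  rw [coneMeasure, Measure.map_apply continuous_mk'.measurable hA,
    measurableEmbedding_val.comap_apply]
  congr 1
  ext v
  constructor
  · rintro ⟨w, hw, rfl⟩
    exact ⟨w.2, hw⟩
  · rintro ⟨hv, h⟩
    exact ⟨⟨v, hv⟩, h, rfl⟩

theorem measurePreserving_volume (U : Hilb d ≃ₗᵢ[ℂ] Hilb d) :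
    MeasurePreserving U (volume : Measure (Hilb d)) volume := by
  let U' : Hilb d ≃ₗᵢ[ℝ] Hilb d :=
    { U.toLinearEquiv.restrictScalars ℝ with norm_map' := U.norm_map }
  exact U'.measurePreserving

theorem measurePreserving_coneMeasure (U : Hilb d ≃ₗᵢ[ℂ] Hilb d) :
    MeasurePreserving (unitaryAct U) (coneMeasure d) (coneMeasure d) := by
  refine ⟨measurable_unitaryAct U, Measure.ext fun A hA => ?_⟩
  rw [Measure.map_apply (measurable_unitaryAct U) hA,
    coneMeasure_apply (measurable_unitaryAct U hA), coneMeasure_apply hA]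
  have e : {v : Hilb d | ∃ hv : v ≠ 0, Projectivization.mk ℂ v hv ∈ unitaryAct U ⁻¹' A} =
      U ⁻¹' {v : Hilb d | ∃ hv : v ≠ 0, Projectivization.mk ℂ v hv ∈ A} := by
    ext v
    constructor
    · rintro ⟨hv, h⟩
      exact ⟨(map_ne_zero_iff U U.injective).2 hv, h⟩
    · rintro ⟨hv, h⟩
      exact ⟨(map_ne_zero_iff U U.injective).1 hv, h⟩
  rw [e]
  exact (measurePreserving_volume U).measure_preimage_equiv (f := U.toHomeomorph.toMeasurableEquiv) _

theorem coneMeasure_iInter_overlap {ι : Type*} [Finite ι] [Nonempty ι] (x : ι → Hilb d) {B : ι → Set ℝ}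
    (hB : ∀ i, MeasurableSet (B i)) (h : coneMeasure d (⋂ i, overlap (x i) ⁻¹' B i) = 0) :
    volume ((fun v i => vecOverlap (x i) v) ⁻¹' (Set.pi univ B) ∩ {v : Hilb d | v ≠ 0}) = 0 := by
  rw [coneMeasure_apply (MeasurableSet.iInter fun i => measurable_overlap _ (hB i))] at h
  refine measure_mono_null ?_ h
  rintro v ⟨hv, hv0⟩
  refine ⟨hv0, mem_iInter.2 fun i => ?_⟩
  rw [mem_preimage, overlap_mk]
  exact hv i (mem_univ i)

end ConeMeasure

theorem exists_unit_orthogonal {s : Finset (Hilb d)} (hs : s.card < d) :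
    ∃ u : State d, ∀ x ∈ s, inner ℂ x (u : Hilb d) = 0 := by
  have hne : (Submodule.span ℂ (s : Set (Hilb d)))ᗮ ≠ ⊥ := by
    intro h
    rw [Submodule.orthogonal_eq_bot_iff] at h
    have h1 := finrank_span_finset_le_card (R := ℂ) s
    rw [Set.finrank, h, finrank_top, finrank_euclideanSpace_fin] at h1
    omega
  obtain ⟨u, hu, hu0⟩ := Submodule.exists_mem_ne_zero_of_ne_bot hne
  refine ⟨⟨((‖u‖ : ℂ)⁻¹) • u, by simp [norm_smul, hu0]⟩, fun x hx => ?_⟩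
  rw [inner_smul_right, (Submodule.mem_orthogonal _ _).1 hu x (Submodule.subset_span hx), mul_zero]

/-! ### Overlaps in a null set, for the invariant measure class. -/

section NullSets

theorem volume_preimage_vecOverlap_line {ψ : State d} {v : Hilb d}
    (hv : v ∉ Submodule.span ℂ {(ψ : Hilb d)}) {N : Set ℝ} (hN : volume N = 0) :
    volume ((fun s : ℝ => vecOverlap ψ (v + s • (ψ : Hilb d))) ⁻¹' N) = 0 := by
  have hψ : ‖(ψ : Hilb d)‖ = 1 := norm_eq_of_mem_sphere ψ
  set a : ℂ := inner ℂ (ψ : Hilb d) v with ha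
  have hK : 0 < ‖v‖ ^ 2 - (a.re ^ 2 + a.im ^ 2) := by
    have h1 : ‖a‖ < ‖v‖ := by
      refine lt_of_le_of_ne (by simpa [hψ] using norm_inner_le_norm (𝕜 := ℂ) (ψ : Hilb d) v) ?_
      intro h
      have hv0 : v ≠ 0 := fun h0 => hv (by rw [h0]; exact Submodule.zero_mem _)
      have := (norm_inner_eq_norm_iff (𝕜 := ℂ) (ne_zero_of_mem_unit_sphere ψ) hv0).1
        (by rw [hψ, one_mul]; exact h)
      obtain ⟨r, -, hr⟩ := this
      exact hv (hr ▸ Submodule.smul_mem _ _ (Submodule.mem_span_singleton_self _))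
    have h2 : ‖a‖ ^ 2 < ‖v‖ ^ 2 := by gcongr
    rw [Complex.sq_norm, Complex.normSq_apply] at h2
    nlinarith
  have hden : ∀ s : ℝ, 0 < ‖v‖ ^ 2 + 2 * s * a.re + s ^ 2 := fun s => by
    nlinarith [sq_nonneg (a.re + s), sq_nonneg a.im]
  have hform : (fun s : ℝ => vecOverlap ψ (v + s • (ψ : Hilb d))) = fun s : ℝ =>
      ((a.re + s) ^ 2 + a.im ^ 2) / (‖v‖ ^ 2 + 2 * s * a.re + s ^ 2) := by
    ext s
    have e : s • (ψ : Hilb d) = (s : ℂ) • (ψ : Hilb d) := (Complex.coe_smul s _).symm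
    rw [vecOverlap, e, inner_add_right, inner_smul_right, inner_self_eq_norm_sq_to_K, hψ, ← ha]
    congr 1
    · rw [Complex.sq_norm, Complex.normSq_apply]
      simp
      ring
    · rw [norm_add_sq (𝕜 := ℂ), inner_smul_right, norm_smul, hψ, ← inner_conj_symm, ← ha]
      simp
      ring
  rw [hform]
  -- The function is `q / (q + K)` with `q = |a + s|²` and `K = ‖v‖² - |a|² > 0`. It has its strict
  -- minimum at `s = -Re a`, so any other point shows that it is not constant.
  refine volume_preimage_eq_zero_of_analytic (x := -a.re) (y := -a.re + 1) (fun s _ => ?_) ?_ hN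
  · exact AnalyticAt.div (by fun_prop) (by fun_prop) (hden s).ne'
  · have h1 := hden (-a.re)
    have h2 := hden (-a.re + 1)
    rw [Ne, div_eq_div_iff h1.ne' h2.ne']
    intro h
    nlinarith

/-- Fubini over translations in the direction of `ψ`: the overlap is a nonconstant analytic function
along every such line outside the subspace spanned by `ψ`, which is proper, hence null, for `d ≥ 2`.
-/
theorem coneMeasure_overlap_preimage_null (hd : 2 ≤ d) (ψ : State d) {N : Set ℝ}
    (hNm : MeasurableSet N) (hN : volume N = 0) : coneMeasure d (overlap ψ ⁻¹' N) = 0 := by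
  set K := Submodule.span ℂ {(ψ : Hilb d)} with hK
  have hKtop : K.restrictScalars ℝ ≠ ⊤ := by
    intro h
    have hK' : K = ⊤ := by
      rw [eq_top_iff]
      intro x _
      have : x ∈ K.restrictScalars ℝ := h ▸ Submodule.mem_top
      exact this
    obtain ⟨u, hu⟩ := exists_unit_orthogonal (s := {(ψ : Hilb d)}) (by rw [Finset.card_singleton]; omega)
    have huK : (u : Hilb d) ∈ K := hK' ▸ Submodule.mem_top
    have hu' : (u : Hilb d) ∈ Kᗮ := by
      rw [hK, Submodule.mem_orthogonal_singleton_iff_inner_right]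
      exact hu _ (by simp)
    exact ne_zero_of_mem_unit_sphere u
      (inner_self_eq_zero.1 (Submodule.inner_right_of_mem_orthogonal huK hu'))
  have hK0 : volume (K : Set (Hilb d)) = 0 :=
    Measure.addHaar_submodule volume (K.restrictScalars ℝ) hKtop
  have hKm : MeasurableSet (K : Set (Hilb d)) := K.closed_of_finiteDimensional.measurableSet
  have hm : MeasurableSet ((K : Set (Hilb d)) ∪ (vecOverlap (ψ : Hilb d) ⁻¹' N)ᶜ) :=
    hKm.union (measurable_vecOverlap _ hNm).compl
  have hae := ae_mem_of_ae_add_linearMap_mem (LinearMap.toSpanSingleton ℝ (Hilb d) (ψ : Hilb d))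
    (volume : Measure ℝ) (volume : Measure (Hilb d)) hm (fun v => by
      simp only [LinearMap.toSpanSingleton_apply]
      by_cases hv : v ∈ K
      · refine Eventually.of_forall fun s => Or.inl (K.add_mem hv ?_)
        rw [← Complex.coe_smul]
        exact K.smul_mem _ (Submodule.mem_span_singleton_self _)
      · have := measure_eq_zero_iff_ae_notMem.1 (volume_preimage_vecOverlap_line hv hN)
        exact this.mono fun s hs => Or.inr hs)
  rw [coneMeasure_apply (measurable_overlap _ hNm)]
  refine measure_mono_null (t := (K : Set (Hilb d)) ∪
    ((K : Set (Hilb d)) ∪ (vecOverlap (ψ : Hilb d) ⁻¹' N)ᶜ)ᶜ) ?_ (measure_union_null hK0 hae)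
  rintro v ⟨hv, h⟩
  rw [mem_preimage, overlap_mk] at h
  by_cases hvK : v ∈ K
  · exact Or.inl hvK
  · exact Or.inr fun hcon => hcon.elim hvK fun h' => h' h

end NullSets

/-! ### Phase rotations as a one-parameter family in the stabilizers. -/

section PhaseRotation

/-- Multiplication by `exp (i θ)` on the line of the unit vector `f`, and the identity on its
orthogonal complement. -/
noncomputable def phaseRotation (f : State d) (θ : ℝ) : Hilb d ≃ₗᵢ[ℂ] Hilb d :=
  LinearIsometry.toLinearIsometryEquiv
    { toLinearMap := LinearMap.id +
        (Complex.exp (θ * Complex.I) - 1) • (innerₛₗ ℂ (f : Hilb d)).smulRight (f : Hilb d)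
      norm_map' := fun v => by
        have hf : ‖(f : Hilb d)‖ = 1 := norm_eq_of_mem_sphere f
        have hff : inner ℂ (f : Hilb d) (f : Hilb d) = 1 := by
          rw [inner_self_eq_norm_sq_to_K, hf]; simp
        set a : ℂ := inner ℂ (f : Hilb d) v with ha
        have key : ∀ c : ℂ, ‖(v - a • (f : Hilb d)) + c • (f : Hilb d)‖ ^ 2 =
            ‖v - a • (f : Hilb d)‖ ^ 2 + ‖c‖ ^ 2 := fun c => by
          have h0 : inner ℂ (v - a • (f : Hilb d)) (c • (f : Hilb d)) = 0 := by
            rw [inner_smul_right, inner_sub_left, inner_smul_left, hff, ha, inner_conj_symm]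
            simp
          rw [norm_add_sq (𝕜 := ℂ), h0, norm_smul, hf]
          simp
        have h1 := key (Complex.exp (θ * Complex.I) * a)
        have h2 := key a
        rw [norm_mul, Complex.norm_exp_ofReal_mul_I, one_mul, ← h2, sub_add_cancel,
          pow_left_inj₀ (norm_nonneg _) (norm_nonneg _) two_ne_zero] at h1
        rw [← h1]
        congr 1
        simp only [LinearMap.add_apply, LinearMap.id_apply, LinearMap.smul_apply,
          LinearMap.smulRight_apply, innerₛₗ_apply_apply, ← ha]
        module }
    rfl

theorem phaseRotation_apply (f : State d) (θ : ℝ) (v : Hilb d) :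
    phaseRotation f θ v =
      v + ((Complex.exp (θ * Complex.I) - 1) * inner ℂ (f : Hilb d) v) • (f : Hilb d) := by
  rw [mul_smul]
  rfl

theorem continuous_phaseRotation (f : State d) :
    Continuous fun p : ℝ × Hilb d => phaseRotation f p.1 p.2 := by
  simp only [phaseRotation_apply]
  fun_prop

theorem phaseRotation_apply_of_inner_eq_zero {f : State d} {x : Hilb d}
    (hx : inner ℂ (f : Hilb d) x = 0) (θ : ℝ) : phaseRotation f θ x = x := by
  rw [phaseRotation_apply, hx, mul_zero, zero_smul, add_zero]

theorem inner_self_state (f : State d) : inner ℂ (f : Hilb d) (f : Hilb d) = 1 := by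
  rw [inner_self_eq_norm_sq_to_K, norm_eq_of_mem_sphere f]; simp

theorem overlap_phaseRotation_self (f : State d) (θ : ℝ) (l : CP d) :
    overlap f (unitaryAct (phaseRotation f θ) l) = overlap f l := by
  induction l using Projectivization.ind with
  | h v hv =>
    rw [unitaryAct_mk, overlap_mk, overlap_mk, vecOverlap, vecOverlap,
      LinearIsometryEquiv.norm_map, phaseRotation_apply, inner_add_right, inner_smul_right,
      inner_self_state]
    congr 2
    rw [show inner ℂ (f : Hilb d) v +
      (Complex.exp (θ * Complex.I) - 1) * inner ℂ (f : Hilb d) v * 1 =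
      Complex.exp (θ * Complex.I) * inner ℂ (f : Hilb d) v by ring, norm_mul,
      Complex.norm_exp_ofReal_mul_I, one_mul]

theorem norm_sq_add_exp_mul (A B : ℂ) (θ : ℝ) :
    ‖A + Complex.exp (θ * Complex.I) * B‖ ^ 2 = ‖A‖ ^ 2 + ‖B‖ ^ 2 +
      2 * ((star A * B).re * Real.cos θ - (star A * B).im * Real.sin θ) := by
  simp only [Complex.sq_norm, Complex.normSq_apply, Complex.add_re, Complex.add_im, Complex.mul_re,
    Complex.mul_im, Complex.exp_ofReal_mul_I_re, Complex.exp_ofReal_mul_I_im, Complex.star_def,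
    Complex.conj_re, Complex.conj_im]
  linear_combination (B.re ^ 2 + B.im ^ 2) * Real.sin_sq_add_cos_sq θ

/-- The contributions `A` and `B` to `⟨ψ, v⟩` come from the parts orthogonal to and along `f`. The
rotation changes only their relative phase, and the interference term is not constant when neither
vanishes: opposite phases separate its values, `0` and `π` for its cosine part or `±π / 2` for its
sine part. -/
theorem volume_preimage_vecOverlap_phaseRotation {f : State d} {ψ v : Hilb d} (hv : v ≠ 0)
    (hA : inner ℂ (ψ - inner ℂ (f : Hilb d) ψ • (f : Hilb d)) v ≠ 0)
    (hB : inner ℂ ψ (f : Hilb d) * inner ℂ (f : Hilb d) v ≠ 0) {N : Set ℝ} (hN : volume N = 0) :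
    volume ((fun θ : ℝ => vecOverlap ψ (phaseRotation f θ v)) ⁻¹' N) = 0 := by
  set A : ℂ := inner ℂ (ψ - inner ℂ (f : Hilb d) ψ • (f : Hilb d)) v with hAdef
  set B : ℂ := inner ℂ ψ (f : Hilb d) * inner ℂ (f : Hilb d) v with hBdef
  have hv2 : ‖v‖ ^ 2 ≠ 0 := by positivity
  have hform : (fun θ : ℝ => vecOverlap ψ (phaseRotation f θ v)) = fun θ : ℝ =>
      (‖A‖ ^ 2 + ‖B‖ ^ 2 +
        2 * ((star A * B).re * Real.cos θ - (star A * B).im * Real.sin θ)) / ‖v‖ ^ 2 := by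
    ext θ
    rw [vecOverlap, LinearIsometryEquiv.norm_map, ← norm_sq_add_exp_mul, hAdef, hBdef,
      phaseRotation_apply, inner_add_right, inner_smul_right, inner_sub_left, inner_smul_left,
      inner_conj_symm]
    congr 3
    ring
  have hC : star A * B ≠ 0 := mul_ne_zero (star_ne_zero.2 hA) hB
  have han : AnalyticOnNhd ℝ (fun θ : ℝ => (‖A‖ ^ 2 + ‖B‖ ^ 2 +
        2 * ((star A * B).re * Real.cos θ - (star A * B).im * Real.sin θ)) / ‖v‖ ^ 2) univ :=
    fun θ _ => AnalyticAt.div (by fun_prop) analyticAt_const hv2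
  rw [hform]
  by_cases hre : (star A * B).re = 0
  · have him : (star A * B).im ≠ 0 := fun h => hC (Complex.ext hre h)
    refine volume_preimage_eq_zero_of_analytic (x := Real.pi / 2) (y := -(Real.pi / 2)) han ?_ hN
    simp only [Real.cos_neg, Real.sin_neg, Real.cos_pi_div_two, Real.sin_pi_div_two]
    rw [Ne, div_left_inj' hv2]
    intro h
    exact him (by linarith)
  · refine volume_preimage_eq_zero_of_analytic (x := 0) (y := Real.pi) han ?_ hN
    simp only [Real.cos_zero, Real.sin_zero, Real.cos_pi, Real.sin_pi]
    rw [Ne, div_left_inj' hv2]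
    intro h
    exact hre (by linarith)

end PhaseRotation

/-! ### Stabilizer-invariant measures see no singular overlaps with other states. -/

section Singular

/-- Invariance under all unitary transformations that fix `φ`. -/
def IsStabilizerInvariant (φ : Hilb d) (μ : Measure (CP d)) : Prop :=
  ∀ U : Hilb d ≃ₗᵢ[ℂ] Hilb d, U φ = φ → MeasurePreserving (unitaryAct U) μ μ

/-- As `f ⊥ φ`, the phase rotations about `f` preserve `μ`. By Fubini some rotated copy of the set
is null, because each line enters it only for a null set of angles; invariance returns this to the
set itself. -/
theorem IsStabilizerInvariant.measure_overlap_inter_eq_zero {φ : Hilb d} {μ : Measure (CP d)}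
    [SFinite μ] (hμ : IsStabilizerInvariant φ μ) {f : State d}
    (hf : inner ℂ (f : Hilb d) φ = 0) {ψ : Hilb d} (hψ : inner ℂ ψ (f : Hilb d) ≠ 0) {N : Set ℝ}
    (hNm : MeasurableSet N) (hN : volume N = 0) :
    μ (overlap ψ ⁻¹' N ∩ (overlap (f : Hilb d) ⁻¹' {0}ᶜ ∩
      overlap (ψ - inner ℂ (f : Hilb d) ψ • (f : Hilb d)) ⁻¹' {0}ᶜ)) = 0 := by
  set ψ' := ψ - inner ℂ (f : Hilb d) ψ • (f : Hilb d) with hψ'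
  have hfψ' : inner ℂ (f : Hilb d) ψ' = 0 := by
    rw [hψ', inner_sub_right, inner_smul_right, inner_self_state, mul_one, sub_self]
  set S := overlap ψ ⁻¹' N ∩ (overlap (f : Hilb d) ⁻¹' {0}ᶜ ∩ overlap ψ' ⁻¹' {0}ᶜ) with hS
  have hSm : MeasurableSet S := (measurable_overlap _ hNm).inter
    ((measurable_overlap _ (measurableSet_singleton 0).compl).inter
      (measurable_overlap _ (measurableSet_singleton 0).compl))
  have hcont := continuous_unitaryAct_uncurry (continuous_phaseRotation f)
  have hl : ∀ l : CP d, ∀ᵐ θ : ℝ, unitaryAct (phaseRotation f θ) l ∉ S := by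
    intro l
    by_cases hlD : overlap (f : Hilb d) l ≠ 0 ∧ overlap ψ' l ≠ 0
    · induction l using Projectivization.ind with
      | h v hv =>
        simp only [overlap_mk, vecOverlap] at hlD
        have h1 : inner ℂ (f : Hilb d) v ≠ 0 := fun h => hlD.1 (by simp [h])
        have h2 : inner ℂ ψ' v ≠ 0 := fun h => hlD.2 (by simp [h])
        have := measure_eq_zero_iff_ae_notMem.1
          (volume_preimage_vecOverlap_phaseRotation hv h2 (mul_ne_zero hψ h1) hN)
        refine this.mono fun θ hθ hcon => hθ ?_
        have h3 := hcon.1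
        rwa [mem_preimage, unitaryAct_mk, overlap_mk] at h3
    · refine Eventually.of_forall fun θ hcon => hlD ⟨?_, ?_⟩
      · have := hcon.2.1
        rwa [mem_preimage, overlap_phaseRotation_self] at this
      · have := hcon.2.2
        rwa [mem_preimage,
          overlap_unitaryAct _ (phaseRotation_apply_of_inner_eq_zero hfψ' θ)] at this
  have hmeas : MeasurableSet
      {p : CP d × ℝ | unitaryAct (phaseRotation f p.2) p.1 ∉ S} :=
    ((hcont.comp continuous_swap).measurable hSm).compl
  have hcomm := (Measure.ae_ae_comm (μ := μ) (ν := (volume : Measure ℝ))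
    (p := fun l θ => unitaryAct (phaseRotation f θ) l ∉ S) hmeas).1 (Eventually.of_forall hl)
  obtain ⟨θ, hθ⟩ := hcomm.exists
  rw [← (hμ _ (phaseRotation_apply_of_inner_eq_zero hf θ)).measure_preimage hSm.nullMeasurableSet]
  exact measure_eq_zero_iff_ae_notMem.2 hθ

/-- This is the alternative `A = 0` or `B = 0` for the direction of `f`, multiplied by a power of
`‖f‖`. In this form it needs no normalization, includes `f = 0`, and is a closed condition on `f`,
so that a countable dense set of directions yields all of them outside one null set. -/
theorem IsStabilizerInvariant.ae_inner_mul_eq_zero {φ : Hilb d} {μ : Measure (CP d)}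
    [SFinite μ] (hμ : IsStabilizerInvariant φ μ) {f : Hilb d} (hf : inner ℂ f φ = 0)
    (ψ : Hilb d) {N : Set ℝ} (hNm : MeasurableSet N) (hN : volume N = 0) :
    ∀ᵐ l ∂μ, overlap ψ l ∈ N → inner ℂ ψ f * inner ℂ f l.rep *
      (inner ℂ ψ l.rep * (‖f‖ ^ 2 : ℝ) - inner ℂ ψ f * inner ℂ f l.rep) = 0 := by
  by_cases hf0 : f = 0
  · simp [hf0]
  have hfn : (‖f‖ : ℂ) ≠ 0 := by simpa using hf0
  let u : State d := ⟨((‖f‖ : ℂ)⁻¹) • f, by simp [norm_smul, hf0]⟩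
  have hfu : f = (‖f‖ : ℂ) • (u : Hilb d) := by
    simp only [u, smul_smul, mul_inv_cancel₀ hfn, one_smul]
  by_cases hψf : inner ℂ ψ f = 0
  · simp [hψf]
  have hψu : inner ℂ ψ (u : Hilb d) ≠ 0 := by
    intro h
    rw [hfu, inner_smul_right, h, mul_zero] at hψf
    exact hψf rfl
  have hu : inner ℂ (u : Hilb d) φ = 0 := by
    simp only [u, inner_smul_left, hf, mul_zero]
  have h0 := measure_eq_zero_iff_ae_notMem.1 (hμ.measure_overlap_inter_eq_zero hu hψu hNm hN)
  filter_upwards [h0] with l hl hlN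
  have hprod : inner ℂ (u : Hilb d) l.rep = 0 ∨
      inner ℂ (ψ - inner ℂ (u : Hilb d) ψ • (u : Hilb d)) l.rep = 0 := by
    by_contra! hcon
    have hr : l.rep ≠ 0 := l.rep_nonzero
    refine hl ⟨hlN, ?_, ?_⟩
    · have := hcon.1
      simp only [overlap, vecOverlap, mem_preimage, mem_compl_iff, mem_singleton_iff]
      positivity
    · have := hcon.2
      simp only [overlap, vecOverlap, mem_preimage, mem_compl_iff, mem_singleton_iff]
      positivity
  have e1 : inner ℂ ψ f = ‖f‖ * inner ℂ ψ (u : Hilb d) := by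
    conv_lhs => rw [hfu]
    rw [inner_smul_right]
  have e2 : inner ℂ f l.rep = ‖f‖ * inner ℂ (u : Hilb d) l.rep := by
    conv_lhs => rw [hfu]
    rw [inner_smul_left, Complex.conj_ofReal]
  rw [e1, e2]
  rcases hprod with h | h
  · simp [h]
  · rw [inner_sub_left, inner_smul_left, inner_conj_symm] at h
    push_cast
    linear_combination (‖f‖ : ℂ) ^ 4 * inner ℂ ψ (u : Hilb d) * inner ℂ (u : Hilb d) l.rep * h

theorem IsStabilizerInvariant.ae_forall_inner_mul_eq_zero {φ : Hilb d} {μ : Measure (CP d)}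
    [SFinite μ] (hμ : IsStabilizerInvariant φ μ) (ψ : Hilb d) {N : Set ℝ}
    (hNm : MeasurableSet N) (hN : volume N = 0) :
    ∀ᵐ l ∂μ, overlap ψ l ∈ N → ∀ f : Hilb d, inner ℂ φ f = 0 → inner ℂ ψ f * inner ℂ f l.rep *
      (inner ℂ ψ l.rep * (‖f‖ ^ 2 : ℝ) - inner ℂ ψ f * inner ℂ f l.rep) = 0 := by
  let K := (Submodule.span ℂ {φ})ᗮ
  have h := ae_all_iff.2 fun n : ℕ => hμ.ae_inner_mul_eq_zero
    (f := (TopologicalSpace.denseSeq K n : Hilb d)) (inner_eq_zero_symm.1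
      (Submodule.mem_orthogonal_singleton_iff_inner_right.1 (TopologicalSpace.denseSeq K n).2))
      ψ hNm hN
  filter_upwards [h] with l hl hlN f hf
  have hfK : f ∈ K := Submodule.mem_orthogonal_singleton_iff_inner_right.2 hf
  refine (TopologicalSpace.denseRange_denseSeq K).induction_on
    (p := fun g : K => inner ℂ ψ (g : Hilb d) * inner ℂ (g : Hilb d) l.rep *
      (inner ℂ ψ l.rep * (‖(g : Hilb d)‖ ^ 2 : ℝ) -
        inner ℂ ψ (g : Hilb d) * inner ℂ (g : Hilb d) l.rep) = 0) ⟨f, hfK⟩ ?_ fun n => hl n hlN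
  refine isClosed_eq ?_ continuous_const
  fun_prop

/-- The components `e` of `ψ` and `w` of `v` orthogonal to `φ` are tested on the directions `f = e +
x g` with `g ⊥ φ, e` and `x` real. Few values of `x` suffice to force `w = 0`. -/
theorem eq_smul_of_forall_inner_mul_eq_zero (hd : 3 ≤ d) {φ : State d} {ψ v : Hilb d}
    (hψ : ψ - inner ℂ (φ : Hilb d) ψ • (φ : Hilb d) ≠ 0)
    (h : ∀ f : Hilb d, inner ℂ (φ : Hilb d) f = 0 → inner ℂ ψ f * inner ℂ f v *
      (inner ℂ ψ v * (‖f‖ ^ 2 : ℝ) - inner ℂ ψ f * inner ℂ f v) = 0) :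
    v = inner ℂ (φ : Hilb d) v • (φ : Hilb d) := by
  set e := ψ - inner ℂ (φ : Hilb d) ψ • (φ : Hilb d) with he
  set w := v - inner ℂ (φ : Hilb d) v • (φ : Hilb d) with hw
  have hφe : inner ℂ (φ : Hilb d) e = 0 := by
    rw [he, inner_sub_right, inner_smul_right, inner_self_state, mul_one, sub_self]
  have hφw : inner ℂ (φ : Hilb d) w = 0 := by
    rw [hw, inner_sub_right, inner_smul_right, inner_self_state, mul_one, sub_self]
  have hfw : ∀ f : Hilb d, inner ℂ (φ : Hilb d) f = 0 → inner ℂ f v = inner ℂ f w := fun f hf => by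
    rw [hw, inner_sub_right, inner_smul_right, inner_eq_zero_symm.1 hf, mul_zero, sub_zero]
  have hψf : ∀ f : Hilb d, inner ℂ (φ : Hilb d) f = 0 → inner ℂ ψ f = inner ℂ e f := fun f hf => by
    rw [he, inner_sub_left, inner_smul_left, hf, mul_zero, sub_zero]
  set Q := inner ℂ ψ v
  set z := inner ℂ e w with hz
  set n : ℂ := ((‖e‖ ^ 2 : ℝ) : ℂ) with hn
  have hn0 : n ≠ 0 := by
    rw [hn]
    exact_mod_cast pow_ne_zero 2 (norm_ne_zero_iff.2 hψ)
  have key : ∀ g : Hilb d, inner ℂ (φ : Hilb d) g = 0 → inner ℂ e g = 0 → ∀ x : ℝ,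
      (z + x * inner ℂ g w) *
        (Q * (n + x ^ 2 * ((‖g‖ ^ 2 : ℝ) : ℂ)) - n * (z + x * inner ℂ g w)) = 0 := by
    intro g hφg heg x
    have hφf : inner ℂ (φ : Hilb d) (e + (x : ℂ) • g) = 0 := by
      rw [inner_add_right, inner_smul_right, hφe, hφg, mul_zero, add_zero]
    have h1 := h _ hφf
    rw [hfw _ hφf, hψf _ hφf, norm_add_sq (𝕜 := ℂ), inner_add_left, inner_add_right,
      inner_smul_left, inner_smul_right, heg, norm_smul, inner_self_eq_norm_sq_to_K] at h1
    simp only [Complex.conj_ofReal, mul_zero, add_zero, map_zero, Complex.norm_real, mul_pow,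
      Real.norm_eq_abs, sq_abs, Complex.ofReal_add, Complex.ofReal_mul, Complex.ofReal_pow,
      Complex.coe_algebraMap, ← hz] at h1
    have h2 : n = (‖e‖ : ℂ) ^ 2 := by rw [hn]; push_cast; rfl
    rw [← h2] at h1
    have h3 := (mul_eq_zero.1 (by rw [← mul_assoc]; exact h1 : n * _ = 0)).resolve_left hn0
    push_cast
    exact h3
  -- For `x` and `-x`, either one of the first factors vanishes, so `z² = x² y²`, or both second
  -- factors vanish and their difference gives `y = 0`. The values `x = 1` and `x = 2` are
  -- incompatible unless `y = 0`.
  have hy : ∀ g : Hilb d, inner ℂ (φ : Hilb d) g = 0 → inner ℂ e g = 0 → inner ℂ g w = 0 := by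
    intro g hφg heg
    have k1 := key g hφg heg 1
    have k2 := key g hφg heg (-1)
    have k3 := key g hφg heg 2
    have k4 := key g hφg heg (-2)
    set y := inner ℂ g w
    push_cast at k1 k2 k3 k4
    have hny : n * y = 0 → y = 0 := fun h => (mul_eq_zero.1 h).resolve_left hn0
    have p1 : z ^ 2 = y ^ 2 ∨ y = 0 := by
      rcases mul_eq_zero.1 k1 with a | a
      · left; linear_combination (z - y) * a
      rcases mul_eq_zero.1 k2 with b | b
      · left; linear_combination (z + y) * b
      · right; exact hny (by linear_combination (b - a) / 2)
    have p2 : z ^ 2 = 4 * y ^ 2 ∨ y = 0 := by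
      rcases mul_eq_zero.1 k3 with a | a
      · left; linear_combination (z - 2 * y) * a
      rcases mul_eq_zero.1 k4 with b | b
      · left; linear_combination (z + 2 * y) * b
      · right; exact hny (by linear_combination (b - a) / 4)
    rcases p1 with a | a
    · rcases p2 with b | b
      · exact pow_eq_zero_iff two_ne_zero |>.1 (by linear_combination (a - b) / 3)
      · exact b
    · exact a
  have hz0 : z = 0 := by
    classical
    -- A third direction exists because `d ≥ 3`. Since `⟨g, w⟩ = 0`, adding `g` to `e` changes only
    -- `‖f‖²`, which forces `Q = 0` if `z ≠ 0`.
    obtain ⟨g, hg⟩ := exists_unit_orthogonal (s := {(φ : Hilb d), e})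
      (lt_of_le_of_lt Finset.card_le_two (by omega))
    have hφg := hg φ (by simp)
    have heg := hg e (by simp)
    have hgw := hy g hφg heg
    have k0 := key g hφg heg 0
    have k1 := key g hφg heg 1
    rw [hgw, norm_eq_of_mem_sphere g] at k0 k1
    push_cast at k0 k1
    by_contra hz0
    have a : Q * n - n * z = 0 :=
      (mul_eq_zero.1 (by linear_combination k0 : z * (Q * n - n * z) = 0)).resolve_left hz0
    have b : Q * (n + 1) - n * z = 0 :=
      (mul_eq_zero.1 (by linear_combination k1 : z * (Q * (n + 1) - n * z) = 0)).resolve_left hz0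
    have hQ : Q = 0 := by linear_combination b - a
    rw [hQ] at a
    exact hz0 ((mul_eq_zero.1 (by linear_combination -a : n * z = 0)).resolve_left hn0)
  -- Now `w` is orthogonal to `φ` and `e`, so it is itself an admissible `g`.
  have hw0 := inner_self_eq_zero.1 (hy w hφw hz0)
  exact sub_eq_zero.1 hw0

theorem sub_smul_ne_zero_of_ray_ne {ψ φ : State d} (hne : ψ.ray ≠ φ.ray) :
    (ψ : Hilb d) - inner ℂ (φ : Hilb d) (ψ : Hilb d) • (φ : Hilb d) ≠ 0 := by
  intro h
  refine hne ((Projectivization.mk_eq_mk_iff' ℂ _ _ _ _).2 ⟨_, (sub_eq_zero.1 h).symm⟩)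

/-- For a measure that is invariant under the unitaries that fix `φ`, the overlap with a different
state `ψ` has an absolutely continuous distribution away from `φ`. -/
theorem IsStabilizerInvariant.measure_overlap_sdiff_eq_zero (hd : 3 ≤ d) {φ ψ : State d}
    {μ : Measure (CP d)} [SFinite μ] (hμ : IsStabilizerInvariant (φ : Hilb d) μ)
    (hne : ψ.ray ≠ φ.ray) {N : Set ℝ} (hNm : MeasurableSet N) (hN : volume N = 0) :
    μ (overlap ψ ⁻¹' N \ {φ.ray}) = 0 := by
  refine measure_eq_zero_iff_ae_notMem.2 ?_
  filter_upwards [hμ.ae_forall_inner_mul_eq_zero (ψ : Hilb d) hNm hN] with l hl hcon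
  have h := eq_smul_of_forall_inner_mul_eq_zero hd (sub_smul_ne_zero_of_ray_ne hne) (hl hcon.1)
  refine hcon.2 ?_
  rw [mem_singleton_iff, ← Projectivization.mk_rep l]
  exact (Projectivization.mk_eq_mk_iff' ℂ _ _ _ _).2 ⟨_, h.symm⟩

theorem IsStabilizerInvariant.measure_singleton_eq_zero (hd : 3 ≤ d) {φ ψ : State d}
    {μ : Measure (CP d)} [SFinite μ] (hμ : IsStabilizerInvariant (φ : Hilb d) μ)
    (hne : ψ.ray ≠ φ.ray) : μ {ψ.ray} = 0 := by
  refine measure_mono_null ?_ (hμ.measure_overlap_sdiff_eq_zero hd hne (measurableSet_singleton 1)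
    (by simp))
  rintro _ rfl
  exact ⟨(overlap_eq_one_iff ψ _).2 rfl, hne⟩

end Singular

/-! ### The stabilizer of a state and its orbits on lines. -/

section Stabilizer

instance : ContinuousStar (Hilb d →L[ℂ] Hilb d) :=
  ⟨(ContinuousLinearMap.adjoint (𝕜 := ℂ) (E := Hilb d) (F := Hilb d)).continuous⟩

/-- The group of the unitary transformations that fix `ψ`. -/
def unitaryStabilizer (ψ : Hilb d) : Subgroup (unitary (Hilb d →L[ℂ] Hilb d)) where
  carrier := {U | Unitary.linearIsometryEquiv U ψ = ψ}
  mul_mem' := fun {U V} hU hV => by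
    change Unitary.linearIsometryEquiv (U * V) ψ = ψ
    rw [map_mul]
    exact (congrArg (Unitary.linearIsometryEquiv U) hV).trans hU
  one_mem' := by
    change Unitary.linearIsometryEquiv 1 ψ = ψ
    rw [map_one]
    rfl
  inv_mem' := fun {U} hU => by
    change Unitary.linearIsometryEquiv U⁻¹ ψ = ψ
    rw [map_inv]
    exact (LinearIsometryEquiv.symm_apply_eq _).2 hU.symm

/-- An element of the stabilizer of `ψ` as a linear isometry. -/
noncomputable def stabilizerIsometry {ψ : Hilb d} (U : unitaryStabilizer ψ) :
    Hilb d ≃ₗᵢ[ℂ] Hilb d :=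
  Unitary.linearIsometryEquiv (U : unitary (Hilb d →L[ℂ] Hilb d))

theorem stabilizerIsometry_self {ψ : Hilb d} (U : unitaryStabilizer ψ) :
    stabilizerIsometry U ψ = ψ := U.2

theorem stabilizerIsometry_mul {ψ : Hilb d} (U V : unitaryStabilizer ψ) :
    stabilizerIsometry (U * V) = stabilizerIsometry U * stabilizerIsometry V :=
  map_mul Unitary.linearIsometryEquiv _ _

theorem unitaryAct_mul (U V : Hilb d ≃ₗᵢ[ℂ] Hilb d) (l : CP d) :
    unitaryAct (U * V) l = unitaryAct U (unitaryAct V l) := by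
  induction l using Projectivization.ind with
  | h v hv => rfl

/-- The stabilizer inherits local compactness and second countability from the finite-dimensional
operator space; these provide a Haar measure to which Fubini applies. -/
theorem isClosedEmbedding_unitaryStabilizer (ψ : Hilb d) :
    IsClosedEmbedding fun U : unitaryStabilizer ψ =>
      ((U : unitary (Hilb d →L[ℂ] Hilb d)) : Hilb d →L[ℂ] Hilb d) := by
  have h1 : IsClosed ((unitary (Hilb d →L[ℂ] Hilb d) : Submonoid _) : Set (Hilb d →L[ℂ] Hilb d)) :=
    isClosed_unitary
  have h2 : IsClosed ((unitaryStabilizer ψ : Subgroup _) :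
      Set (unitary (Hilb d →L[ℂ] Hilb d))) := by
    have e : ((unitaryStabilizer ψ : Subgroup _) : Set (unitary (Hilb d →L[ℂ] Hilb d))) =
      {U : unitary (Hilb d →L[ℂ] Hilb d) | (U : Hilb d →L[ℂ] Hilb d) ψ = ψ} := rfl
    rw [e]
    exact isClosed_eq (continuous_subtype_val.clm_apply continuous_const) continuous_const
  exact h1.isClosedEmbedding_subtypeVal.comp h2.isClosedEmbedding_subtypeVal

instance (ψ : Hilb d) : LocallyCompactSpace (unitaryStabilizer ψ) := by
  have : ProperSpace (Hilb d →L[ℂ] Hilb d) := FiniteDimensional.proper ℂ _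
  exact (isClosedEmbedding_unitaryStabilizer ψ).locallyCompactSpace

instance (ψ : Hilb d) : SecondCountableTopology (unitaryStabilizer ψ) := by
  have : ProperSpace (Hilb d →L[ℂ] Hilb d) := FiniteDimensional.proper ℂ _
  exact (isClosedEmbedding_unitaryStabilizer ψ).isEmbedding.secondCountableTopology

noncomputable instance (ψ : Hilb d) : MeasurableSpace (unitaryStabilizer ψ) := borel _

instance (ψ : Hilb d) : BorelSpace (unitaryStabilizer ψ) := ⟨rfl⟩

theorem continuous_stabilizerIsometry_inv (ψ : Hilb d) :
    Continuous fun p : unitaryStabilizer ψ × Hilb d => stabilizerIsometry p.1⁻¹ p.2 := by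
  have h : Continuous fun p : unitaryStabilizer ψ × Hilb d =>
      ((p.1⁻¹ : unitaryStabilizer ψ) : unitary (Hilb d →L[ℂ] Hilb d)) :=
    continuous_subtype_val.comp continuous_fst.inv
  exact (continuous_subtype_val.comp h).clm_apply continuous_snd

theorem finrank_hilb : Module.finrank ℂ (Hilb d) = Fintype.card (Fin d) := by simp

/-- A unit vector is determined up to the unitaries that fix `ψ` by its component along `ψ`. -/
theorem exists_isometry_of_orthogonal (hd : 2 ≤ d) {ψ u v : State d}
    (hu : inner ℂ (ψ : Hilb d) (u : Hilb d) = 0) (hv : inner ℂ (ψ : Hilb d) (v : Hilb d) = 0) :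
    ∃ U : Hilb d ≃ₗᵢ[ℂ] Hilb d, U (ψ : Hilb d) = ψ ∧ U (u : Hilb d) = v := by
  have hb : ∀ w : State d, inner ℂ (ψ : Hilb d) (w : Hilb d) = 0 →
      ∃ b : OrthonormalBasis (Fin d) ℂ (Hilb d), b ⟨0, by omega⟩ = ψ ∧ b ⟨1, by omega⟩ = w := by
    intro w hw
    -- Only the indices `0` and `1` are used; the values at the others are placeholders.
    let x : Fin d → Hilb d := fun i => if i.1 = 0 then ψ else w
    have hx : Orthonormal ℂ (Set.domRestrict {i : Fin d | i.1 < 2} x) := by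
      refine ⟨fun i => ?_, fun i j hij => ?_⟩
      · simp only [Set.domRestrict_apply, x]
        split_ifs <;> exact norm_eq_of_mem_sphere _
      · have h1 : i.1.1 < 2 := i.2
        have h2 : j.1.1 < 2 := j.2
        have h3 : i.1.1 ≠ j.1.1 := fun h => hij (Subtype.ext (Fin.ext h))
        simp only [Set.domRestrict_apply, x]
        split_ifs with h4 h5 h5
        · omega
        · exact hw
        · exact inner_eq_zero_symm.1 hw
        · omega
    obtain ⟨b, hb⟩ := hx.exists_orthonormalBasis_extension_of_card_eq finrank_hilb
    refine ⟨b, ?_, ?_⟩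
    · rw [hb _ (by simp)]; simp [x]
    · rw [hb _ (by simp)]; simp [x]
  obtain ⟨b, hb0, hb1⟩ := hb u hu
  obtain ⟨c, hc0, hc1⟩ := hb v hv
  refine ⟨b.equiv c (Equiv.refl _), ?_, ?_⟩
  · rw [← hb0, OrthonormalBasis.equiv_apply_basis, Equiv.refl_apply, hc0, hb0]
  · rw [← hb1, OrthonormalBasis.equiv_apply_basis, Equiv.refl_apply, hc1]

/-- The standard representative of the orbit of lines with overlap `t`. -/
noncomputable def orbitVec (ψ e : State d) (t : ℝ) : Hilb d :=
  (√t : ℂ) • (ψ : Hilb d) + (√(1 - t) : ℂ) • (e : Hilb d)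

theorem inner_orbitVec {ψ e : State d} (he : inner ℂ (ψ : Hilb d) (e : Hilb d) = 0) (t : ℝ) :
    inner ℂ (ψ : Hilb d) (orbitVec ψ e t) = (√t : ℂ) := by
  rw [orbitVec, inner_add_right, inner_smul_right, inner_smul_right, he, inner_self_state]
  simp

theorem norm_sq_orbitVec {ψ e : State d} (he : inner ℂ (ψ : Hilb d) (e : Hilb d) = 0) (t : ℝ) :
    ‖orbitVec ψ e t‖ ^ 2 = √t ^ 2 + √(1 - t) ^ 2 := by
  rw [orbitVec, norm_add_sq (𝕜 := ℂ), inner_smul_left, inner_smul_right, he, norm_smul, norm_smul,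
    norm_eq_of_mem_sphere ψ, norm_eq_of_mem_sphere e]
  simp

/-- Since `√` is `0` on negative numbers, `√t` and `√(1 - t)` are defined for all real `t`, and they
never vanish together. This makes the section of the overlap a continuous map on all of `ℝ`. -/
theorem orbitVec_ne_zero {ψ e : State d} (he : inner ℂ (ψ : Hilb d) (e : Hilb d) = 0) (t : ℝ) :
    orbitVec ψ e t ≠ 0 := by
  intro h
  have h1 := norm_sq_orbitVec he t
  rw [h, norm_zero] at h1
  rcases le_or_gt t 0 with ht | ht
  · have := Real.sqrt_pos.2 (by linarith : 0 < 1 - t)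
    nlinarith [sq_nonneg (√t)]
  · have := Real.sqrt_pos.2 ht
    nlinarith [sq_nonneg (√(1 - t))]

/-- A continuous section of the overlap with `ψ`. -/
noncomputable def orbitLine {ψ e : State d} (he : inner ℂ (ψ : Hilb d) (e : Hilb d) = 0) (t : ℝ) :
    CP d :=
  Projectivization.mk ℂ (orbitVec ψ e t) (orbitVec_ne_zero he t)

theorem continuous_orbitLine {ψ e : State d} (he : inner ℂ (ψ : Hilb d) (e : Hilb d) = 0) :
    Continuous (orbitLine he) := by
  refine continuous_mk'.comp (f := fun t => (⟨orbitVec ψ e t, orbitVec_ne_zero he t⟩ :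
    {v : Hilb d // v ≠ 0})) (Continuous.subtype_mk ?_ _)
  unfold orbitVec
  have h1 : Continuous fun t : ℝ => ((√t : ℝ) : ℂ) :=
    Complex.continuous_ofReal.comp Real.continuous_sqrt
  have h2 : Continuous fun t : ℝ => ((√(1 - t) : ℝ) : ℂ) :=
    Complex.continuous_ofReal.comp (Real.continuous_sqrt.comp (continuous_const.sub continuous_id))
  exact (h1.smul continuous_const).add (h2.smul continuous_const)

/-- The overlap with `ψ` is a complete invariant of the stabilizer orbits. After a choice of phase
and scale a vector on the line is `√t ψ + w` with `w ⊥ ψ` of norm `√(1 - t)`, and the stabilizer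
acts transitively on the unit vectors orthogonal to `ψ`. -/
theorem exists_unitaryAct_orbitLine (hd : 2 ≤ d) {ψ e : State d}
    (he : inner ℂ (ψ : Hilb d) (e : Hilb d) = 0) (l : CP d) :
    ∃ U : Hilb d ≃ₗᵢ[ℂ] Hilb d, U (ψ : Hilb d) = ψ ∧
      unitaryAct U (orbitLine he (overlap ψ l)) = l := by
  induction l using Projectivization.ind with
  | h v hv =>
    rw [overlap_mk]
    have hψ : ‖(ψ : Hilb d)‖ = 1 := norm_eq_of_mem_sphere ψ
    set a : ℂ := inner ℂ (ψ : Hilb d) v with ha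
    have hvn : 0 < ‖v‖ := norm_pos_iff.2 hv
    obtain ⟨c, hc, hca⟩ : ∃ c : ℂ, ‖c‖ = 1 ∧ c * a = (‖a‖ : ℂ) := by
      by_cases ha0 : a = 0
      · exact ⟨1, by simp, by simp [ha0]⟩
      · have : (‖a‖ : ℂ) ≠ 0 := by simpa using ha0
        refine ⟨(‖a‖ : ℂ) / a, by simp [ha0], div_mul_cancel₀ _ ha0⟩
    set k : ℂ := c / (‖v‖ : ℂ) with hk
    have hk0 : k ≠ 0 := div_ne_zero (norm_ne_zero_iff.1 (by rw [hc]; exact one_ne_zero))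
      (by exact_mod_cast hvn.ne')
    set t := vecOverlap (ψ : Hilb d) v with ht
    have ht1 := vecOverlap_mem_Icc ψ v
    rw [← ht] at ht1
    have hst : √t = ‖a‖ / ‖v‖ := by
      rw [ht, vecOverlap, ← ha, Real.sqrt_div (by positivity), Real.sqrt_sq (norm_nonneg _),
        Real.sqrt_sq (norm_nonneg _)]
    have hka : inner ℂ (ψ : Hilb d) (k • v) = (√t : ℂ) := by
      rw [inner_smul_right, ← ha, hst, hk, div_mul_eq_mul_div, hca]
      push_cast
      rfl
    have hkn : ‖k • v‖ = 1 := by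
      rw [norm_smul, hk, norm_div, hc, Complex.norm_real, Real.norm_eq_abs, abs_of_pos hvn]
      field_simp
    set w := k • v - (√t : ℂ) • (ψ : Hilb d) with hw
    have hψw : inner ℂ (ψ : Hilb d) w = 0 := by
      rw [hw, inner_sub_right, hka, inner_smul_right, inner_self_state, mul_one, sub_self]
    have hwn : ‖w‖ = √(1 - t) := by
      have h1 : ‖(√t : ℂ) • (ψ : Hilb d) + w‖ ^ 2 = t + ‖w‖ ^ 2 := by
        rw [norm_add_sq (𝕜 := ℂ), inner_smul_left, hψw, norm_smul, hψ]
        simp [Real.sq_sqrt ht1.1]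
      rw [hw, add_sub_cancel, hkn, ← hw] at h1
      rw [eq_comm, Real.sqrt_eq_iff_mul_self_eq (by linarith [ht1.2]) (norm_nonneg _)]
      linarith
    obtain ⟨f, hψf, hfw⟩ : ∃ f : State d, inner ℂ (ψ : Hilb d) (f : Hilb d) = 0 ∧
        w = (√(1 - t) : ℂ) • (f : Hilb d) := by
      by_cases hw0 : w = 0
      -- Here `√(1 - t) = 0`, so any unit vector orthogonal to `ψ` serves.
      · refine ⟨e, he, ?_⟩
        rw [← hwn, hw0]
        simp
      · have hwn' : (‖w‖ : ℂ) ≠ 0 := by simpa using hw0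
        refine ⟨⟨(‖w‖ : ℂ)⁻¹ • w, by simp [norm_smul, hw0]⟩, ?_, ?_⟩
        · simp only [inner_smul_right, hψw, mul_zero]
        · simp only [← hwn, smul_smul, mul_inv_cancel₀ hwn', one_smul]
    obtain ⟨U, hUψ, hUe⟩ := exists_isometry_of_orthogonal hd he hψf
    refine ⟨U, hUψ, ?_⟩
    rw [orbitLine, unitaryAct_mk]
    refine (Projectivization.mk_eq_mk_iff' ℂ _ _ _ _).2 ⟨k, ?_⟩
    rw [orbitVec, map_add, map_smul, map_smul, hUψ, hUe, ← hfw, hw]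
    abel

end Stabilizer

/-! ### Averaging over the stabilizer. -/

section Haar

/-- The Haar measure of the set of the unitaries in the stabilizer of `ψ` that bring `l` to `A`. -/
noncomputable def orbitMass (ψ : Hilb d) (A : Set (CP d)) (l : CP d) : ℝ≥0∞ :=
  Measure.haar {U : unitaryStabilizer ψ | unitaryAct (stabilizerIsometry U⁻¹) l ∈ A}

theorem measurableSet_stabilizer_preimage (ψ : Hilb d) {A : Set (CP d)} (hA : MeasurableSet A) :
    MeasurableSet {p : unitaryStabilizer ψ × CP d |
      unitaryAct (stabilizerIsometry p.1⁻¹) p.2 ∈ A} :=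
  (continuous_unitaryAct_uncurry (g := fun U : unitaryStabilizer ψ => stabilizerIsometry U⁻¹)
    (continuous_stabilizerIsometry_inv ψ)).measurable hA

theorem measurable_orbitMass (ψ : Hilb d) {A : Set (CP d)} (hA : MeasurableSet A) :
    Measurable (orbitMass ψ A) :=
  measurable_measure_prodMk_right (measurableSet_stabilizer_preimage ψ hA)

/-- The inverse in `orbitMass` turns the action of `V` into a left translation of `U`, under which
Haar measure is invariant. -/
theorem orbitMass_unitaryAct {ψ : Hilb d} (A : Set (CP d)) {V : Hilb d ≃ₗᵢ[ℂ] Hilb d}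
    (hV : V ψ = ψ) (l : CP d) : orbitMass ψ A (unitaryAct V l) = orbitMass ψ A l := by
  let V' : unitaryStabilizer ψ := ⟨Unitary.linearIsometryEquiv.symm V, by
    change Unitary.linearIsometryEquiv (Unitary.linearIsometryEquiv.symm V) ψ = ψ
    rw [MulEquiv.apply_symm_apply, hV]⟩
  have hV' : stabilizerIsometry V' = V := MulEquiv.apply_symm_apply _ _
  rw [orbitMass, orbitMass, ← measure_preimage_mul Measure.haar V'⁻¹
    {U : unitaryStabilizer ψ | unitaryAct (stabilizerIsometry U⁻¹) l ∈ A}]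
  congr 1
  ext U
  simp only [mem_ofPred_eq, mem_preimage]
  rw [← hV', ← unitaryAct_mul, ← stabilizerIsometry_mul, mul_inv_rev, inv_inv]

/-- Fubini for Haar measure times `μ`: all translates of the set by the stabilizer have the same
measure, so nullity can be tested on almost every orbit. It thus depends only on a function that is
constant on orbits, in the same way for every invariant `μ`. -/
theorem IsStabilizerInvariant.measure_inter_overlap_eq_zero_iff {ψ : Hilb d} {μ : Measure (CP d)}
    [SFinite μ] (hμ : IsStabilizerInvariant ψ μ) {A : Set (CP d)} (hA : MeasurableSet A)
    {B : Set ℝ} (hB : MeasurableSet B) :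
    μ (A ∩ overlap ψ ⁻¹' B) = 0 ↔ μ ({l | orbitMass ψ A l ≠ 0} ∩ overlap ψ ⁻¹' B) = 0 := by
  have hBm := measurable_overlap ψ hB
  have hp : MeasurableSet {p : unitaryStabilizer ψ × CP d |
      ¬ (unitaryAct (stabilizerIsometry p.1⁻¹) p.2 ∈ A ∧ overlap ψ p.2 ∈ B)} :=
    ((measurableSet_stabilizer_preimage ψ hA).inter (measurable_snd hBm)).compl
  have hcomm := Measure.ae_ae_comm (μ := (Measure.haar : Measure (unitaryStabilizer ψ))) (ν := μ)
    (p := fun U l => ¬ (unitaryAct (stabilizerIsometry U⁻¹) l ∈ A ∧ overlap ψ l ∈ B)) hp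
  have h1 : ∀ U : unitaryStabilizer ψ,
      (∀ᵐ l ∂μ, ¬ (unitaryAct (stabilizerIsometry U⁻¹) l ∈ A ∧ overlap ψ l ∈ B)) ↔
        μ (A ∩ overlap ψ ⁻¹' B) = 0 := by
    intro U
    rw [← (hμ _ (stabilizerIsometry_self U⁻¹)).measure_preimage (hA.inter hBm).nullMeasurableSet,
      measure_eq_zero_iff_ae_notMem]
    simp only [mem_preimage, mem_inter_iff, overlap_unitaryAct _ (stabilizerIsometry_self U⁻¹)]
  simp only [h1] at hcomm
  rw [eventually_const] at hcomm
  rw [hcomm, measure_eq_zero_iff_ae_notMem]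
  refine eventually_congr (Eventually.of_forall fun l => ?_)
  refine (measure_eq_zero_iff_ae_notMem (s := {U : unitaryStabilizer ψ |
    unitaryAct (stabilizerIsometry U⁻¹) l ∈ A ∧ overlap ψ l ∈ B})).symm.trans ?_
  by_cases hl : overlap ψ l ∈ B
  · simp [hl, orbitMass]
  · simp [hl]

theorem isStabilizerInvariant_coneMeasure (ψ : Hilb d) :
    IsStabilizerInvariant ψ (coneMeasure d) := fun U _ => measurePreserving_coneMeasure U

/-- If Lebesgue measure on `S` is dominated by the distribution of the overlap with `ψ`, then the
unitarily invariant measure of the lines with overlap in `S` is dominated by `μ`. -/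
theorem IsStabilizerInvariant.coneMeasure_inter_eq_zero (hd : 2 ≤ d) {ψ : State d}
    {μ : Measure (CP d)} [SFinite μ] (hμ : IsStabilizerInvariant (ψ : Hilb d) μ) {S : Set ℝ}
    (hS : MeasurableSet S) (hSμ : volume.restrict S ≪ μ.map (overlap ψ)) {A : Set (CP d)}
    (hA : MeasurableSet A) (hA0 : μ A = 0) : coneMeasure d (A ∩ overlap ψ ⁻¹' S) = 0 := by
  obtain ⟨e, he'⟩ := exists_unit_orthogonal (s := {(ψ : Hilb d)})
    (by rw [Finset.card_singleton]; omega)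
  have he := he' ψ (by simp)
  -- `Z` consists of the overlap values whose orbit meets `A` in positive Haar mass. Nullity of `A`
  -- for `μ` makes `Z` null for the law of the overlap, so `Z ∩ S` is Lebesgue null, which makes `A`
  -- null over `S` for the invariant measure.
  set Z : Set ℝ := {t | orbitMass (ψ : Hilb d) A (orbitLine he t) ≠ 0} with hZ
  have hZm : MeasurableSet Z := (measurable_orbitMass _ hA).comp
    (continuous_orbitLine he).measurable (measurableSet_singleton 0).compl
  have hZeq : {l | orbitMass (ψ : Hilb d) A l ≠ 0} = overlap (ψ : Hilb d) ⁻¹' Z := by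
    ext l
    obtain ⟨U, hU, hUl⟩ := exists_unitaryAct_orbitLine hd he l
    simp only [hZ, mem_ofPred_eq, mem_preimage]
    rw [← orbitMass_unitaryAct A hU (orbitLine he (overlap (ψ : Hilb d) l)), hUl]
  have h1 : μ (overlap (ψ : Hilb d) ⁻¹' Z) = 0 := by
    have := (hμ.measure_inter_overlap_eq_zero_iff hA MeasurableSet.univ).1 (by simpa using hA0)
    rwa [hZeq, preimage_univ, inter_univ] at this
  have h2 : volume (Z ∩ S) = 0 := by
    rw [← Measure.restrict_apply hZm]
    refine hSμ ?_
    rw [Measure.map_apply (measurable_overlap _) hZm, h1]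
  rw [(isStabilizerInvariant_coneMeasure (ψ : Hilb d)).measure_inter_overlap_eq_zero_iff hA hS,
    hZeq, ← preimage_inter]
  exact coneMeasure_overlap_preimage_null hd ψ (hZm.inter hS) h2

end Haar

/-- Mutually singular `P` and `Q` are the Jordan decomposition of `P - Q`, whose total variation is
therefore `2`. -/
theorem tvDist_eq_one_of_mutuallySingular {Λ : Type*} [MeasurableSpace Λ]
    {P Q : ProbabilityMeasure Λ} (h : (P : Measure Λ) ⟂ₘ (Q : Measure Λ)) : tvDist P Q = 1 := by
  let j : JordanDecomposition Λ :=
    { posPart := P, negPart := Q, mutuallySingular := h }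
  have hj : (P : Measure Λ).toSignedMeasure - (Q : Measure Λ).toSignedMeasure =
    j.toSignedMeasure := rfl
  rw [tvDist, hj, SignedMeasure.totalVariation,
    JordanDecomposition.toJordanDecomposition_toSignedMeasure]
  simp only [j, Measure.add_apply, measure_univ]
  rw [one_add_one_eq_two, ENNReal.div_self two_ne_zero ENNReal.ofNat_ne_top]

/-! ### Singular and absolutely continuous parts of the law of the overlap. -/

section RegularPart

/-- `N` carries the singular part and `S` the absolutely continuous part of a measure on the unit
interval, where all the points of `S` are density points of `S`. -/
structure IsRegularPart (ν : Measure ℝ) (N S : Set ℝ) : Prop where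
  measurableSet_null : MeasurableSet N
  measurableSet : MeasurableSet S
  volume_null : volume N = 0
  measure_compl : ν (N ∪ S)ᶜ = 0
  absolutelyContinuous : volume.restrict S ≪ ν
  subset_Ioo : S ⊆ Ioo 0 1
  volume_inter_ball_ne_zero : ∀ t ∈ S, ∀ ε > 0, volume (S ∩ ball t ε) ≠ 0

/-- `S` is the set where the Radon–Nikodym density is nonzero in `(0,1)`, cut down to the support of
Lebesgue measure on it. The points lost in this cut are null and join `N`, as do the endpoints.
Membership in the support is all that is needed of a density point. -/
theorem exists_isRegularPart (ν : Measure ℝ) [IsFiniteMeasure ν] (hν : ν (Icc 0 1)ᶜ = 0) :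
    ∃ N S, IsRegularPart ν N S := by
  have hsing := Measure.mutuallySingular_singularPart ν volume
  set f := ν.rnDeriv volume with hf
  have hfm : Measurable f := Measure.measurable_rnDeriv ν volume
  have hdec : ν = ν.singularPart volume + volume.withDensity f :=
    Measure.haveLebesgueDecomposition_add ν volume
  set S₁ : Set ℝ := {t | f t ≠ 0} ∩ Ioo 0 1 with hS₁
  have hS₁m : MeasurableSet S₁ :=
    (hfm (measurableSet_singleton 0).compl).inter measurableSet_Ioo
  set K := (volume.restrict S₁).support with hK
  have hKm : MeasurableSet K := Measure.isClosed_support.measurableSet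
  have hdiff : volume (S₁ \ K) = 0 := by
    have : (volume.restrict S₁) Kᶜ = 0 := Measure.measure_compl_support
    rwa [Measure.restrict_apply hKm.compl, inter_comm, ← sdiff_eq] at this
  have h01 : volume ({0, 1} : Set ℝ) = 0 := (Set.toFinite _).measure_zero _
  refine ⟨hsing.nullSetᶜ ∪ {0, 1} ∪ (S₁ \ K), S₁ ∩ K, ?_, ?_, ?_, ?_, ?_, ?_, ?_⟩
  · exact (hsing.measurableSet_nullSet.compl.union (Set.toFinite _).measurableSet).union
      (hS₁m.diff hKm)
  · exact hS₁m.inter hKm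
  · exact measure_union_null (measure_union_null hsing.measure_compl_nullSet h01) hdiff
  · refine measure_mono_null (t := (Icc 0 1)ᶜ ∪ (hsing.nullSet ∩ {t | f t = 0})) ?_
      (measure_union_null hν ?_)
    · intro t ht
      by_cases htI : t ∈ Icc (0 : ℝ) 1
      · refine Or.inr ⟨by_contra fun h => ht (Or.inl (Or.inl (Or.inl h))), ?_⟩
        by_contra hft
        have h0 : t ≠ 0 := fun h => ht (Or.inl (Or.inl (Or.inr (Or.inl h))))
        have h1 : t ≠ 1 := fun h => ht (Or.inl (Or.inl (Or.inr (Or.inr h))))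
        have htS : t ∈ S₁ := ⟨hft, lt_of_le_of_ne htI.1 (Ne.symm h0), lt_of_le_of_ne htI.2 h1⟩
        by_cases htK : t ∈ K
        · exact ht (Or.inr ⟨htS, htK⟩)
        · exact ht (Or.inl (Or.inr ⟨htS, htK⟩))
      · exact Or.inl htI
    · have hm0 : MeasurableSet {t | f t = 0} := hfm (measurableSet_singleton 0)
      have hadd := congrArg (fun m : Measure ℝ => m (hsing.nullSet ∩ {t | f t = 0})) hdec
      refine hadd.trans ?_
      rw [Measure.add_apply, add_eq_zero]
      refine ⟨measure_mono_null inter_subset_left hsing.measure_nullSet,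
        measure_mono_null inter_subset_right ?_⟩
      rw [withDensity_apply _ hm0]
      exact setLIntegral_eq_zero hm0 fun t ht => ht
  · have h1 : volume.restrict (S₁ ∩ K) ≪ (volume.restrict (S₁ ∩ K)).withDensity f := by
      refine withDensity_absolutelyContinuous' hfm.aemeasurable ?_
      exact (ae_restrict_mem (hS₁m.inter hKm)).mono fun t ht => ht.1.1
    refine h1.trans ?_
    rw [← restrict_withDensity (hS₁m.inter hKm)]
    refine Measure.restrict_le_self.absolutelyContinuous.trans ?_
    exact (Measure.withDensity_rnDeriv_le ν volume).absolutelyContinuous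
  · exact fun t ht => ht.1.2
  · intro t ht ε hε h0
    have hpos := (Measure.mem_support_iff_forall t).1 ht.2 _ (ball_mem_nhds t hε)
    rw [Measure.restrict_apply measurableSet_ball] at hpos
    refine hpos.ne' (measure_mono_null (t := (S₁ ∩ K ∩ ball t ε) ∪ (S₁ \ K)) ?_
      (measure_union_null h0 hdiff))
    rintro x ⟨hx, hxS⟩
    by_cases hxK : x ∈ K
    · exact Or.inl ⟨⟨hxS, hxK⟩, hx⟩
    · exact Or.inr ⟨hxS, hxK⟩

end RegularPart

/-! ### Joint overlaps with several states as a submersion. -/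

section Submersion

theorem real_inner_hilb (x y : Hilb d) : inner ℝ x y = (inner ℂ x y).re := by
  simp [PiLp.inner_apply, Complex.inner, mul_comm]

/-- The real linear functional `u ↦ 2 Re ⟨g, u⟩`. -/
noncomputable def reInner (g : Hilb d) : Hilb d →L[ℝ] ℝ :=
  (2 : ℝ) • (Complex.reCLM.comp ((innerSL ℂ g).restrictScalars ℝ))

theorem reInner_apply (g u : Hilb d) : reInner g u = 2 * (inner ℂ g u).re := rfl

theorem contDiffAt_vecOverlap (x : Hilb d) {v : Hilb d} (hv : v ≠ 0) :
    ContDiffAt ℝ 1 (vecOverlap x) v := by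
  unfold vecOverlap
  refine ContDiffAt.div ?_ ?_ (by positivity)
  · exact ContDiffAt.norm_sq ℝ ((innerSL ℂ x).restrictScalars ℝ).contDiff.contDiffAt
  · exact ContDiffAt.norm_sq ℝ contDiffAt_id

/-- The quotient rule at a unit vector. The term in `v` comes from the denominator and makes the
gradient orthogonal to `v`, as scale invariance requires. -/
theorem hasFDerivAt_vecOverlap (x : Hilb d) {v : Hilb d} (hv : ‖v‖ = 1) :
    HasFDerivAt (vecOverlap x)
      (reInner (inner ℂ x v • x - (vecOverlap x v : ℂ) • v)) v := by
  have h1 : HasFDerivAt (fun u : Hilb d => ‖inner ℂ x u‖ ^ 2) _ v :=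
    ((innerSL ℂ x).restrictScalars ℝ).hasFDerivAt.norm_sq
  have h2 : HasFDerivAt (fun u : Hilb d => ‖u‖ ^ 2) _ v := (hasFDerivAt_id v).norm_sq
  have hne : ‖v‖ ^ 2 ≠ 0 := by rw [hv]; norm_num
  have h3 : HasFDerivAt (vecOverlap x) _ v := h1.mul ((hasDerivAt_inv hne).comp_hasFDerivAt v h2)
  refine h3.congr_fderiv ?_
  ext u
  have hr : vecOverlap x v = ‖inner ℂ x v‖ ^ 2 := by rw [vecOverlap, hv]; simp
  simp only [hv, id]
  rw [reInner_apply, inner_sub_left, inner_smul_left, inner_smul_left, hr]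
  generalize ‖inner ℂ x v‖ ^ 2 = c
  simp [real_inner_hilb, Complex.inner]
  ring

/-- The map `T` is half the adjoint of `L`, so `L ∘ T` is twice the real Gram matrix of the `g i`.
It is injective by real linear independence, hence bijective as an endomorphism of a
finite-dimensional space. -/
theorem surjective_pi_reInner {ι : Type*} [Fintype ι] {g : ι → Hilb d}
    (hg : ∀ w : ι → ℝ, ∑ i, (w i : ℂ) • g i = 0 → w = 0) :
    Function.Surjective (ContinuousLinearMap.pi fun i => reInner (g i)) := by
  let T : (ι → ℝ) →ₗ[ℝ] Hilb d :=
    { toFun := fun w => ∑ i, (w i : ℂ) • g i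
      map_add' := fun a b => by simp [add_smul, Finset.sum_add_distrib]
      map_smul' := fun c a => by
        simp only [Pi.smul_apply, smul_eq_mul, Complex.ofReal_mul, mul_smul, Finset.smul_sum,
          RingHom.id_apply, Complex.coe_smul] }
  let L : Hilb d →ₗ[ℝ] (ι → ℝ) :=
    (ContinuousLinearMap.pi fun i => reInner (g i) : Hilb d →L[ℝ] (ι → ℝ))
  have hinj : Function.Injective (L ∘ₗ T) := by
    rw [← LinearMap.ker_eq_bot, LinearMap.ker_eq_bot']
    intro w hw
    apply hg
    have h1 : ∀ i, (inner ℂ (g i) (T w)).re = 0 := fun i => by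
      have : reInner (g i) (T w) = 0 := congrFun hw i
      rw [reInner_apply] at this
      linarith
    have h2 : inner ℂ (T w) (T w) = ∑ i, (w i : ℂ) * inner ℂ (g i) (T w) := by
      have : T w = ∑ i, (w i : ℂ) • g i := rfl
      conv_lhs => rw [this, sum_inner]
      refine Finset.sum_congr rfl fun i _ => ?_
      rw [inner_smul_left, Complex.conj_ofReal, ← this]
    have h3 : (inner ℂ (T w) (T w)).re = 0 := by
      rw [h2, Complex.re_sum]
      refine Finset.sum_eq_zero fun i _ => ?_
      rw [Complex.re_ofReal_mul, h1, mul_zero]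
    have h4 : ‖T w‖ ^ 2 = 0 := by
      rw [← h3, inner_self_eq_norm_sq_to_K]
      norm_cast
    exact norm_eq_zero.1 (pow_eq_zero_iff two_ne_zero |>.1 h4)
  have hsurj := LinearMap.injective_iff_surjective.1 hinj
  intro y
  obtain ⟨w, hw⟩ := hsurj y
  exact ⟨T w, hw⟩

theorem volume_pi_inter_ball_ne_zero {ι : Type*} [Fintype ι] {B : ι → Set ℝ} {t : ι → ℝ}
    (h : ∀ i, ∀ ε > 0, volume (B i ∩ ball (t i) ε) ≠ 0) {ε : ℝ} (hε : 0 < ε) :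
    volume (Set.pi univ B ∩ ball t ε) ≠ 0 := by
  rw [ball_pi t hε, ← Set.pi_inter_distrib, volume_pi_pi]
  exact Finset.prod_ne_zero_iff.2 fun i _ => h i ε hε

/-- The overlaps with several states have jointly a density near the overlaps of a line at which
their gradients are linearly independent. -/
theorem coneMeasure_iInter_overlap_ne_zero {ι : Type*} [Fintype ι] [Nonempty ι]
    {x : ι → Hilb d} {v : Hilb d} (hv : ‖v‖ = 1)
    (hg : ∀ w : ι → ℝ,
      ∑ i, (w i : ℂ) • (inner ℂ (x i) v • x i - (vecOverlap (x i) v : ℂ) • v) = 0 → w = 0)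
    {B : ι → Set ℝ} (hBm : ∀ i, MeasurableSet (B i))
    (hB : ∀ i, ∀ ε > 0, volume (B i ∩ ball (vecOverlap (x i) v) ε) ≠ 0) :
    coneMeasure d (⋂ i, overlap (x i) ⁻¹' B i) ≠ 0 := by
  intro h0
  have hv0 : v ≠ 0 := norm_ne_zero_iff.1 (by rw [hv]; exact one_ne_zero)
  have h1 := coneMeasure_iInter_overlap x hBm h0
  have h2 : volume ((fun v i => vecOverlap (x i) v) ⁻¹' (Set.pi univ B)) = 0 := by
    have : Nontrivial (Hilb d) := ⟨v, 0, hv0⟩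
    refine measure_mono_null (t := _ ∪ {(0 : Hilb d)}) ?_
      (measure_union_null h1 (measure_singleton 0))
    intro u hu
    by_cases hu0 : u = 0
    · exact Or.inr hu0
    · exact Or.inl ⟨hu, hu0⟩
  refine measure_preimage_ne_zero_of_surjective volume volume
    (contDiffAt_pi.2 fun i => contDiffAt_vecOverlap (x i) hv0)
    (hasFDerivAt_pi.2 fun i => hasFDerivAt_vecOverlap (x i) hv)
    (surjective_pi_reInner hg) (fun ε hε => volume_pi_inter_ball_ne_zero hB hε) ?_ h2
  exact (measurable_pi_lambda _ fun i => measurable_vecOverlap (x i))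
    (MeasurableSet.univ_pi hBm)

end Submersion

/-! ### Bases, superpositions and angles between lines. -/

theorem inner_self_eq_ofReal (v : Hilb d) : inner ℂ v v = ((‖v‖ ^ 2 : ℝ) : ℂ) := by
  rw [inner_self_eq_norm_sq_to_K]
  push_cast
  rfl

theorem exists_orthonormalBasis_apply_zero (hd : 0 < d) (ψ : State d) :
    ∃ b : OrthonormalBasis (Fin d) ℂ (Hilb d), b ⟨0, hd⟩ = ψ := by
  have hx : Orthonormal ℂ (Set.domRestrict {(⟨0, hd⟩ : Fin d)} fun _ => (ψ : Hilb d)) := by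
    refine ⟨fun i => norm_eq_of_mem_sphere ψ, fun i j hij => ?_⟩
    exact absurd (Subtype.ext (i.2.trans j.2.symm)) hij
  obtain ⟨b, hb⟩ := hx.exists_orthonormalBasis_extension_of_card_eq finrank_hilb
  exact ⟨b, hb _ rfl⟩

/-- The superposition of orthogonal states with squared amplitudes `t` and `1 - t`. -/
noncomputable def superposition {ψ e : State d} (he : inner ℂ (ψ : Hilb d) (e : Hilb d) = 0)
    {t : ℝ} (ht : t ∈ Icc (0 : ℝ) 1) : State d :=
  ⟨orbitVec ψ e t, by
    have h := norm_sq_orbitVec he t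
    rw [Real.sq_sqrt ht.1, Real.sq_sqrt (by linarith [ht.2])] at h
    rw [mem_sphere_zero_iff_norm]
    exact (pow_eq_one_iff_of_nonneg (norm_nonneg _) two_ne_zero).1 (by linarith)⟩

theorem inner_superposition {ψ e : State d} (he : inner ℂ (ψ : Hilb d) (e : Hilb d) = 0)
    {t : ℝ} (ht : t ∈ Icc (0 : ℝ) 1) :
    inner ℂ (ψ : Hilb d) (superposition he ht : Hilb d) = (√t : ℂ) := inner_orbitVec he t

theorem ray_superposition_ne {ψ e : State d} (he : inner ℂ (ψ : Hilb d) (e : Hilb d) = 0)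
    {t : ℝ} (ht : t ∈ Icc (0 : ℝ) 1) (ht1 : t < 1) : (superposition he ht).ray ≠ ψ.ray := by
  rw [Ne, ← overlap_eq_one_iff, State.ray, overlap_mk, vecOverlap, inner_superposition,
    norm_eq_of_mem_sphere]
  simp [Real.sq_sqrt ht.1, ht1.ne]

/-- The triangle inequality for the angles between the lines of `ψ`, `l` and `φ`. -/
theorem sqrt_overlap_mul_sub_le (ψ φ : State d) (l : CP d) :
    √(overlap ψ l) * √(overlap φ l) - √(1 - overlap ψ l) * √(1 - overlap φ l) ≤
      ‖inner ℂ (ψ : Hilb d) (φ : Hilb d)‖ := by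
  obtain ⟨v, hv⟩ : ∃ v : State d, v.ray = l := by
    induction l using Projectivization.ind with
    | h v hv =>
      have hvn : (‖v‖ : ℂ) ≠ 0 := by simpa using hv
      refine ⟨⟨(‖v‖ : ℂ)⁻¹ • v, by simp [norm_smul, hv]⟩, ?_⟩
      exact (Projectivization.mk_eq_mk_iff' ℂ _ _ _ _).2 ⟨_, rfl⟩
  have hvv := norm_eq_of_mem_sphere v
  have key : ∀ χ : State d, ∃ χ' : Hilb d,
      (χ : Hilb d) = inner ℂ (v : Hilb d) (χ : Hilb d) • (v : Hilb d) + χ' ∧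
      inner ℂ (v : Hilb d) χ' = 0 ∧ ‖χ'‖ = √(1 - overlap χ l) ∧
      ‖inner ℂ (v : Hilb d) (χ : Hilb d)‖ = √(overlap χ l) := by
    intro χ
    set a := inner ℂ (v : Hilb d) (χ : Hilb d) with ha
    have ho : overlap χ l = ‖a‖ ^ 2 := by
      rw [← hv, State.ray, overlap_mk, vecOverlap, hvv, ha, norm_inner_symm]
      simp
    have h0 : inner ℂ (v : Hilb d) ((χ : Hilb d) - a • (v : Hilb d)) = 0 := by
      rw [inner_sub_right, inner_smul_right, inner_self_state, mul_one, sub_self]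
    refine ⟨(χ : Hilb d) - a • (v : Hilb d), by abel, h0, ?_, ?_⟩
    · have h1 : ‖a • (v : Hilb d) + ((χ : Hilb d) - a • (v : Hilb d))‖ ^ 2 =
          ‖a‖ ^ 2 + ‖(χ : Hilb d) - a • (v : Hilb d)‖ ^ 2 := by
        rw [norm_add_sq (𝕜 := ℂ), inner_smul_left, h0, norm_smul, hvv]
        simp
      rw [add_sub_cancel, norm_eq_of_mem_sphere] at h1
      rw [ho, ← Real.sqrt_sq (norm_nonneg ((χ : Hilb d) - a • (v : Hilb d)))]
      congr 1
      linarith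
    · rw [ho, Real.sqrt_sq (norm_nonneg _)]
  obtain ⟨ψ', h1, h2, h3, h4⟩ := key ψ
  obtain ⟨φ', k1, k2, k3, k4⟩ := key φ
  have e : inner ℂ (ψ : Hilb d) (φ : Hilb d) =
      inner ℂ (ψ : Hilb d) (v : Hilb d) * inner ℂ (v : Hilb d) (φ : Hilb d) + inner ℂ ψ' φ' := by
    conv_lhs => rw [h1, k1]
    rw [inner_add_left, inner_add_right, inner_add_right, inner_smul_left, inner_smul_left,
      inner_smul_right, inner_smul_right, inner_self_state, k2, inner_eq_zero_symm.1 h2,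
      inner_conj_symm]
    ring
  have h5 : ‖inner ℂ ψ' φ'‖ ≤ √(1 - overlap ψ l) * √(1 - overlap φ l) := by
    rw [← h3, ← k3]
    exact norm_inner_le_norm _ _
  have h6 := norm_sub_norm_le (inner ℂ (ψ : Hilb d) (v : Hilb d) * inner ℂ (v : Hilb d) (φ : Hilb d))
    (-inner ℂ ψ' φ')
  rw [sub_neg_eq_add, ← e, norm_neg, norm_mul, norm_inner_symm, h4, k4] at h6
  linarith

/-! ### What overlap and measurements impose on the absolutely continuous parts. -/

namespace OntologicalTheory

/-- The sets `N` and `S` split the distribution of the overlap with `ψ` of the ontic state. -/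
def IsRegularPartAt (T : OntologicalTheory d (CP d)) (ψ : State d) (N S : Set ℝ) : Prop :=
  IsRegularPart ((T.μ ψ : Measure (CP d)).map (overlap ψ)) N S

theorem exists_isRegularPartAt (T : OntologicalTheory d (CP d)) (ψ : State d) :
    ∃ N S, T.IsRegularPartAt ψ N S := by
  refine exists_isRegularPart _ ?_
  rw [Measure.map_apply (measurable_overlap _) measurableSet_Icc.compl]
  have : overlap (ψ : Hilb d) ⁻¹' (Icc 0 1)ᶜ = ∅ :=
    eq_empty_of_forall_notMem fun l hl => hl (overlap_mem_Icc ψ l)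
  rw [this, measure_empty]

theorem IsRegularPartAt.measure_preimage_compl {T : OntologicalTheory d (CP d)} {ψ : State d}
    {N S : Set ℝ} (h : T.IsRegularPartAt ψ N S) :
    (T.μ ψ : Measure (CP d)) (overlap ψ ⁻¹' (N ∪ S)ᶜ) = 0 := by
  have := h.measure_compl
  rwa [Measure.map_apply (measurable_overlap _)
    (h.measurableSet_null.union h.measurableSet).compl] at this

/-- Different states with nontrivial overlap have a common ontic state in their absolutely
continuous parts. -/
theorem NontrivialOverlap.exists_overlap_mem (hd : 3 ≤ d) {T : OntologicalTheory d (CP d)}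
    (hT : T.IsSymmetric) {ψ φ : State d} (h : T.NontrivialOverlap ψ φ) (hne : ψ.ray ≠ φ.ray)
    {N S N' S' : Set ℝ} (hψ : T.IsRegularPartAt ψ N S) (hφ : T.IsRegularPartAt φ N' S') :
    ∃ l : CP d, overlap ψ l ∈ S ∧ overlap φ l ∈ S' := by
  by_contra! hcon
  have iψ : IsStabilizerInvariant (ψ : Hilb d) (T.μ ψ : Measure (CP d)) := hT ψ
  have iφ : IsStabilizerInvariant (φ : Hilb d) (T.μ φ : Measure (CP d)) := hT φ
  -- `X` and `X'` contain the singular parts of the two measures up to null sets, and each is null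
  -- for the other measure. If no line had overlaps in both `S` and `S'`, these sets and the
  -- absolutely continuous parts would separate the measures.
  set X := overlap (ψ : Hilb d) ⁻¹' N \ {φ.ray} with hX
  set X' := overlap (φ : Hilb d) ⁻¹' N' \ {ψ.ray} with hX'
  have hXm : MeasurableSet X :=
    (measurable_overlap _ hψ.measurableSet_null).diff (measurableSet_singleton_ray φ)
  have hXm' : MeasurableSet X' :=
    (measurable_overlap _ hφ.measurableSet_null).diff (measurableSet_singleton_ray ψ)
  have hX0 : (T.μ φ : Measure (CP d)) X = 0 :=
    iφ.measure_overlap_sdiff_eq_zero hd hne hψ.measurableSet_null hψ.volume_null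
  have hX0' : (T.μ ψ : Measure (CP d)) X' = 0 :=
    iψ.measure_overlap_sdiff_eq_zero hd hne.symm hφ.measurableSet_null hφ.volume_null
  have hsing : (T.μ ψ : Measure (CP d)) ⟂ₘ (T.μ φ : Measure (CP d)) := by
    refine ⟨X' ∪ (overlap (φ : Hilb d) ⁻¹' S' \ X),
      hXm'.union ((measurable_overlap _ hφ.measurableSet).diff hXm), ?_, ?_⟩
    · refine measure_union_null hX0' (measure_mono_null
        (t := overlap (ψ : Hilb d) ⁻¹' (N ∪ S)ᶜ ∪ {φ.ray}) ?_
        (measure_union_null hψ.measure_preimage_compl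
          (iψ.measure_singleton_eq_zero hd hne.symm)))
      rintro l ⟨hl, hlX⟩
      by_cases hlφ : l = φ.ray
      · exact Or.inr hlφ
      · refine Or.inl fun hl' => hl'.elim (fun hN => hlX ⟨hN, hlφ⟩) fun hS => hcon l hS hl
    · refine measure_mono_null (t := overlap (φ : Hilb d) ⁻¹' (N' ∪ S')ᶜ ∪ ({ψ.ray} ∪ X)) ?_
        (measure_union_null hφ.measure_preimage_compl
          (measure_union_null (iφ.measure_singleton_eq_zero hd hne) hX0))
      intro l hl
      by_cases hlψ : l = ψ.ray
      · exact Or.inr (Or.inl hlψ)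
      by_cases hlX : l ∈ X
      · exact Or.inr (Or.inr hlX)
      · exact Or.inl fun hl' => hl (hl'.elim (fun hN => Or.inl ⟨hN, hlψ⟩)
          fun hS => Or.inr ⟨hS, hlX⟩)
  have h1 : tvDist (T.μ ψ) (T.μ φ) < 1 := h
  rw [tvDist_eq_one_of_mutuallySingular hsing] at h1
  exact lt_irrefl _ h1

/-- States that are excluded one by one by the outcomes of a measurement have no common ontic
states in their absolutely continuous parts. -/
theorem coneMeasure_iInter_eq_zero_of_orthogonal (hd : 2 ≤ d) {T : OntologicalTheory d (CP d)}
    (hT : T.IsSymmetric) {ι : Type*} {χ : ι → State d} {N S : ι → Set ℝ}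
    (hS : ∀ i, T.IsRegularPartAt (χ i) (N i) (S i))
    (M : OrthonormalBasis (Fin d) ℂ (Hilb d)) (f : Fin d → ι)
    (h : ∀ k, inner ℂ (M k) (χ (f k) : Hilb d) = 0) :
    coneMeasure d (⋂ i, overlap (χ i) ⁻¹' S i) = 0 := by
  -- The outcome `k` has probability zero in the state `χ (f k)`, so its nonnegative response
  -- function vanishes almost everywhere for that state.
  have hA : ∀ k, (T.μ (χ (f k)) : Measure (CP d)) {l | T.ξ M k l ≠ 0} = 0 := by
    intro k
    have hborn := T.born M k (χ (f k))
    rw [h k, norm_zero, zero_pow two_ne_zero] at hborn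
    have hint : Integrable (T.ξ M k) (T.μ (χ (f k)) : Measure (CP d)) := by
      refine Integrable.of_bound (T.measurable_ξ M k).aestronglyMeasurable 1
        (Eventually.of_forall fun l => ?_)
      rw [Real.norm_eq_abs, abs_of_nonneg (T.ξ_mem_Icc M k l).1]
      exact (T.ξ_mem_Icc M k l).2
    exact (integral_eq_zero_iff_of_nonneg (fun l => (T.ξ_mem_Icc M k l).1) hint).1 hborn
  have h0 : ∀ k, coneMeasure d ({l | T.ξ M k l ≠ 0} ∩ overlap (χ (f k)) ⁻¹' S (f k)) = 0 :=
    fun k => IsStabilizerInvariant.coneMeasure_inter_eq_zero hd (hT (χ (f k))) (hS _).measurableSet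
      (hS _).absolutelyContinuous (T.measurable_ξ M k (measurableSet_singleton 0).compl) (hA k)
  refine measure_mono_null ?_ (measure_iUnion_null h0)
  intro l hl
  rw [mem_iInter] at hl
  by_contra hcon
  have hξ : ∀ k, T.ξ M k l = 0 := fun k => by
    by_contra hk
    exact hcon (mem_iUnion.2 ⟨k, hk, hl (f k)⟩)
  have := T.sum_ξ M l
  simp [hξ] at this

/-- A basis containing `ψ` excludes `φ` by its outcome `ψ` and `ψ` by all the others. If `s + t <
1`, a vector with squared amplitudes `s`, `t` and `1 - s - t > 0` along `ψ`, `φ` and a third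
direction would have overlaps `s` and `t` with independent gradients, and the common part could not
be null. -/
theorem one_le_add_of_inner_eq_zero (hd : 3 ≤ d) {T : OntologicalTheory d (CP d)}
    (hT : T.IsSymmetric) {ψ φ : State d} (hψφ : inner ℂ (ψ : Hilb d) (φ : Hilb d) = 0)
    {N S N' S' : Set ℝ} (hψ : T.IsRegularPartAt ψ N S) (hφ : T.IsRegularPartAt φ N' S')
    {s t : ℝ} (hs : s ∈ S) (ht : t ∈ S') : 1 ≤ s + t := by
  classical
  by_contra! hst
  have hs0 := (hψ.subset_Ioo hs).1
  have ht0 := (hφ.subset_Ioo ht).1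
  obtain ⟨b, hb⟩ := exists_orthonormalBasis_apply_zero (by omega : 0 < d) ψ
  obtain ⟨χ, hχ⟩ := exists_unit_orthogonal (s := {(ψ : Hilb d), (φ : Hilb d)})
    (lt_of_le_of_lt Finset.card_le_two (by omega))
  have hψχ : inner ℂ (ψ : Hilb d) (χ : Hilb d) = 0 := hχ ψ (by simp)
  have hφχ : inner ℂ (φ : Hilb d) (χ : Hilb d) = 0 := hχ φ (by simp)
  have hφψ := inner_eq_zero_symm.1 hψφ
  have hχψ := inner_eq_zero_symm.1 hψχ
  have hχφ := inner_eq_zero_symm.1 hφχ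
  obtain ⟨α, hα0, hα⟩ : ∃ α : ℝ, 0 < α ∧ α ^ 2 = s := ⟨√s, Real.sqrt_pos.2 hs0, Real.sq_sqrt hs0.le⟩
  obtain ⟨β, hβ0, hβ⟩ : ∃ β : ℝ, 0 < β ∧ β ^ 2 = t := ⟨√t, Real.sqrt_pos.2 ht0, Real.sq_sqrt ht0.le⟩
  obtain ⟨γ, hγ0, hγ⟩ : ∃ γ : ℝ, 0 < γ ∧ γ ^ 2 = 1 - s - t :=
    ⟨√(1 - s - t), Real.sqrt_pos.2 (by linarith), Real.sq_sqrt (by linarith)⟩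
  set v : Hilb d := (α : ℂ) • (ψ : Hilb d) + (β : ℂ) • (φ : Hilb d) + (γ : ℂ) • (χ : Hilb d) with hv
  have iψ : inner ℂ (ψ : Hilb d) v = α := by
    simp only [hv, inner_add_right, inner_smul_right, inner_self_state, hψφ, hψχ]
    ring
  have iφ : inner ℂ (φ : Hilb d) v = β := by
    simp only [hv, inner_add_right, inner_smul_right, inner_self_state, hφψ, hφχ]
    ring
  have iχ : inner ℂ (χ : Hilb d) v = γ := by
    simp only [hv, inner_add_right, inner_smul_right, inner_self_state, hχψ, hχφ]
    ring
  have hvn : ‖v‖ = 1 := by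
    have h1 : inner ℂ v v = (α : ℂ) ^ 2 + (β : ℂ) ^ 2 + (γ : ℂ) ^ 2 := by
      conv_lhs => rw [hv, inner_add_left, inner_add_left, inner_smul_left, inner_smul_left,
        inner_smul_left, ← hv, iψ, iφ, iχ]
      simp only [Complex.conj_ofReal]
      ring
    rw [inner_self_eq_ofReal] at h1
    have h2 : ‖v‖ ^ 2 = 1 := by
      have : ‖v‖ ^ 2 = α ^ 2 + β ^ 2 + γ ^ 2 := by exact_mod_cast h1
      linarith
    exact (pow_eq_one_iff_of_nonneg (norm_nonneg _) two_ne_zero).1 h2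
  have oψ : vecOverlap (ψ : Hilb d) v = s := by
    rw [vecOverlap, iψ, hvn, Complex.norm_real, Real.norm_eq_abs, sq_abs, hα]
    simp
  have oφ : vecOverlap (φ : Hilb d) v = t := by
    rw [vecOverlap, iφ, hvn, Complex.norm_real, Real.norm_eq_abs, sq_abs, hβ]
    simp
  refine coneMeasure_iInter_overlap_ne_zero (x := fun i => ((![ψ, φ] i : State d) : Hilb d)) hvn
    ?_ (B := ![S, S']) ?_ ?_
    (coneMeasure_iInter_eq_zero_of_orthogonal (by omega) hT (χ := ![ψ, φ]) (N := ![N, N'])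
      (S := ![S, S']) ?_ b (fun k => if k.1 = 0 then 1 else 0) ?_)
  · intro w hw
    rw [Fin.sum_univ_two] at hw
    simp only [Matrix.cons_val_zero, Matrix.cons_val_one, iψ, iφ, oψ, oφ] at hw
    have e1 := congrArg (inner ℂ (χ : Hilb d)) hw
    have e2 := congrArg (inner ℂ (ψ : Hilb d)) hw
    have e3 := congrArg (inner ℂ (φ : Hilb d)) hw
    simp only [inner_add_right, inner_smul_right, inner_sub_right, inner_self_state, iψ, iφ, iχ,
      hψφ, hφψ, hχψ, hχφ, inner_zero_right] at e1 e2 e3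
    norm_cast at e1 e2 e3
    -- In the third direction only the terms along `v` contribute. This is where `γ ≠ 0` is needed;
    -- afterwards these terms also drop out of the other two components.
    have hW : w 0 * s + w 1 * t = 0 := by
      have : (w 0 * s + w 1 * t) * γ = 0 := by linear_combination -e1
      exact (mul_eq_zero.1 this).resolve_right hγ0.ne'
    have h0 : w 0 * α = 0 := by linear_combination e2 + α * hW
    have h1 : w 1 * β = 0 := by linear_combination e3 + β * hW
    funext i
    fin_cases i
    · exact (mul_eq_zero.1 h0).resolve_right hα0.ne'
    · exact (mul_eq_zero.1 h1).resolve_right hβ0.ne'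
  · intro i
    fin_cases i
    · exact hψ.measurableSet
    · exact hφ.measurableSet
  · intro i ε hε
    fin_cases i
    · simpa [oψ] using hψ.volume_inter_ball_ne_zero s hs ε hε
    · simpa [oφ] using hφ.volume_inter_ball_ne_zero t ht ε hε
  · intro i
    fin_cases i
    · exact hψ
    · exact hφ
  · intro k
    by_cases hk : k.1 = 0
    · have : k = ⟨0, by omega⟩ := Fin.ext hk
      simp only [if_true, Matrix.cons_val_one, this, hb]
      exact hψφ
    · simp only [hk, if_false, Matrix.cons_val_zero]
      rw [← hb]
      exact b.orthonormal.2 fun h => hk (by rw [h])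

/-- In the orthogonal complement of `ψ` there are two almost orthogonal states. If `s < 1/2`, every
ontic line common to their absolutely continuous parts has overlap at least `1 - s > 1/2` with both,
and the angle inequality keeps the two states away from orthogonality. -/
theorem half_le_of_mem (hd : 3 ≤ d) {T : OntologicalTheory d (CP d)} (hT : T.IsSymmetric)
    (hm : T.IsMaximallyNontrivial) {ψ : State d} {N S : Set ℝ} (hψ : T.IsRegularPartAt ψ N S)
    {s : ℝ} (hs : s ∈ S) : 1 / 2 ≤ s := by
  classical
  by_contra! hs2
  have hs0 := (hψ.subset_Ioo hs).1
  obtain ⟨e, he⟩ := exists_unit_orthogonal (s := {(ψ : Hilb d)})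
    (by rw [Finset.card_singleton]; omega)
  obtain ⟨f, hf⟩ := exists_unit_orthogonal (s := {(ψ : Hilb d), (e : Hilb d)})
    (lt_of_le_of_lt Finset.card_le_two (by omega))
  have hψe := he ψ (by simp)
  have hψf := hf ψ (by simp)
  have hef := hf e (by simp)
  -- The angle inequality will give `|⟨e, φ⟩| ≥ (1 - s) - s`, so any positive inner product below `1
  -- - 2 * s` works.
  set δ : ℝ := (1 - 2 * s) / 2 with hδ
  have hδ0 : 0 < δ := by rw [hδ]; linarith
  have hδ1 : δ < 1 := by rw [hδ]; linarith
  have hδI : δ ^ 2 ∈ Icc (0 : ℝ) 1 := ⟨by positivity, by nlinarith⟩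
  set φ := superposition hef hδI with hφ
  have heφ : inner ℂ (e : Hilb d) (φ : Hilb d) = (δ : ℂ) := by
    rw [hφ, inner_superposition, Real.sqrt_sq hδ0.le]
  have hψφ : inner ℂ (ψ : Hilb d) (φ : Hilb d) = 0 := by
    rw [hφ]
    change inner ℂ (ψ : Hilb d) (orbitVec e f (δ ^ 2)) = 0
    rw [orbitVec, inner_add_right, inner_smul_right, inner_smul_right, hψe, hψf]
    simp
  obtain ⟨N₁, S₁, h₁⟩ := T.exists_isRegularPartAt e
  obtain ⟨N₂, S₂, h₂⟩ := T.exists_isRegularPartAt φ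
  have hov : T.NontrivialOverlap e φ := hm e φ (by
    rw [heφ]
    exact_mod_cast hδ0.ne')
  obtain ⟨l, hl₁, hl₂⟩ := hov.exists_overlap_mem hd hT
    (ray_superposition_ne hef hδI (by nlinarith)).symm h₁ h₂
  have g₁ := one_le_add_of_inner_eq_zero hd hT hψe hψ h₁ hs hl₁
  have g₂ := one_le_add_of_inner_eq_zero hd hT hψφ hψ h₂ hs hl₂
  have hle := sqrt_overlap_mul_sub_le e φ l
  rw [heφ, Complex.norm_real, Real.norm_eq_abs, abs_of_pos hδ0] at hle
  have a : 1 - s ≤ √(overlap (e : Hilb d) l) * √(overlap (φ : Hilb d) l) := by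
    rw [← Real.mul_self_sqrt (by linarith : (0 : ℝ) ≤ 1 - s)]
    gcongr <;> linarith
  have b : √(1 - overlap (e : Hilb d) l) * √(1 - overlap (φ : Hilb d) l) ≤ s := by
    conv_rhs => rw [← Real.mul_self_sqrt hs0.le]
    gcongr <;> linarith
  rw [hδ] at hle
  linarith

/-- A common line of two almost orthogonal states has overlap at least `1/2` with each, that is,
angles at most `π / 4`. These angles must add up to nearly `π / 2`, so both overlaps are close to
`1/2`. -/
theorem volume_inter_ball_half_ne_zero (hd : 3 ≤ d) {T : OntologicalTheory d (CP d)}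
    (hT : T.IsSymmetric) (hm : T.IsMaximallyNontrivial) {ψ : State d} {N S : Set ℝ}
    (hψ : T.IsRegularPartAt ψ N S) {ε : ℝ} (hε : 0 < ε) : volume (S ∩ ball (1 / 2) ε) ≠ 0 := by
  obtain ⟨e, he⟩ := exists_unit_orthogonal (s := {(ψ : Hilb d)})
    (by rw [Finset.card_singleton]; omega)
  have hψe := he ψ (by simp)
  set δ : ℝ := min ε 1 / 2 with hδ
  have hδ0 : 0 < δ := by positivity
  have hδ1 : δ < 1 := by
    have := min_le_right ε 1
    linarith
  have hδε : δ < ε := by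
    have := min_le_left ε 1
    linarith
  have hδI : δ ^ 2 ∈ Icc (0 : ℝ) 1 := ⟨by positivity, by nlinarith⟩
  set φ := superposition hψe hδI with hφ
  have hψφ : inner ℂ (ψ : Hilb d) (φ : Hilb d) = (δ : ℂ) := by
    rw [hφ, inner_superposition, Real.sqrt_sq hδ0.le]
  obtain ⟨N', S', h'⟩ := T.exists_isRegularPartAt φ
  have hov : T.NontrivialOverlap ψ φ := hm ψ φ (by
    rw [hψφ]
    exact_mod_cast hδ0.ne')
  obtain ⟨l, hl, hl'⟩ := hov.exists_overlap_mem hd hT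
    (ray_superposition_ne hψe hδI (by nlinarith)).symm hψ h'
  have hs := half_le_of_mem hd hT hm hψ hl
  have ht := half_le_of_mem hd hT hm h' hl'
  have hle := sqrt_overlap_mul_sub_le ψ φ l
  rw [hψφ, Complex.norm_real, Real.norm_eq_abs, abs_of_pos hδ0] at hle
  have hsI := overlap_mem_Icc ψ l
  set s := overlap (ψ : Hilb d) l with hsdef
  set t := overlap (φ : Hilb d) l
  have hsε : s < 1 / 2 + ε := by
    by_contra! hcon
    have hx := Real.sq_sqrt hsI.1
    have hy := Real.sq_sqrt (by linarith [hsI.2] : (0 : ℝ) ≤ 1 - s)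
    have hx0 := Real.sqrt_nonneg s
    have hy0 := Real.sqrt_nonneg (1 - s)
    have hm2 := Real.sq_sqrt (by norm_num : (0 : ℝ) ≤ 1 / 2)
    have hm0 := Real.sqrt_nonneg (1 / 2)
    have ht1 : √(1 / 2) ≤ √t := Real.sqrt_le_sqrt ht
    have ht2 : √(1 - t) ≤ √(1 / 2) := Real.sqrt_le_sqrt (by linarith)
    have hyx : √(1 - s) ≤ √s := Real.sqrt_le_sqrt (by linarith)
    set x := √s
    set y := √(1 - s)
    set m := √(1 / 2)
    -- The angle inequality, with `√t` and `√(1 - t)` replaced by their bounds at `t = 1/2`.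
    -- Multiplied by `m * (x + y) ≤ 1` it becomes `s - 1/2 ≤ δ < ε`.
    have h1 : m * (x - y) ≤ δ := by
      have := mul_le_mul_of_nonneg_left ht1 hx0
      have := mul_le_mul_of_nonneg_left ht2 hy0
      linarith
    have h2 : m * (x + y) ≤ 1 := by
      have : (m * (x + y)) ^ 2 ≤ 1 := by
        rw [mul_pow, hm2]
        nlinarith [sq_nonneg (x - y)]
      exact (sq_le_one_iff₀ (by positivity)).1 this
    have h3 : (m * (x - y)) * (m * (x + y)) = (2 * s - 1) / 2 := by
      linear_combination (x ^ 2 - y ^ 2) * hm2 + (hx - hy) / 2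
    have h4 : (m * (x - y)) * (m * (x + y)) ≤ m * (x - y) :=
      mul_le_of_le_one_right (mul_nonneg hm0 (by linarith)) h2
    linarith
  have hsmem : s ∈ ball (1 / 2 : ℝ) ε := by
    rw [mem_ball, Real.dist_eq, abs_lt]
    constructor <;> linarith
  obtain ⟨ρ, hρ, hρs⟩ := Metric.isOpen_iff.1 isOpen_ball s hsmem
  exact fun h0 => hψ.volume_inter_ball_ne_zero s hl ρ hρ
    (measure_mono_null (inter_subset_inter_right _ hρs) h0)

end OntologicalTheory

/-! ### Three states excluded one by one by a basis. -/

section Triple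

/-- The vector with the given first three coordinates in the basis `M`. -/
noncomputable def tripleVec (hd : 3 ≤ d) (M : OrthonormalBasis (Fin d) ℂ (Hilb d)) (a b c : ℂ) :
    Hilb d :=
  a • M ⟨0, by omega⟩ + b • M ⟨1, by omega⟩ + c • M ⟨2, by omega⟩

theorem inner_tripleVec (hd : 3 ≤ d) (M : OrthonormalBasis (Fin d) ℂ (Hilb d)) (a b c : ℂ)
    (k : Fin d) : inner ℂ (M k) (tripleVec hd M a b c) =
      if k.1 = 0 then a else if k.1 = 1 then b else if k.1 = 2 then c else 0 := by
  simp only [tripleVec, inner_add_right, inner_smul_right, M.inner_eq_ite, Fin.ext_iff]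
  split_ifs <;> first | omega | simp

theorem inner_tripleVec_tripleVec (hd : 3 ≤ d) (M : OrthonormalBasis (Fin d) ℂ (Hilb d))
    (a b c a' b' c' : ℂ) : inner ℂ (tripleVec hd M a b c) (tripleVec hd M a' b' c') =
      star a * a' + star b * b' + star c * c' := by
  conv_lhs => rw [tripleVec]
  simp only [inner_add_left, inner_smul_left, inner_tripleVec]
  simp

theorem norm_sq_tripleVec (hd : 3 ≤ d) (M : OrthonormalBasis (Fin d) ℂ (Hilb d)) (a b c : ℂ) :
    ‖tripleVec hd M a b c‖ ^ 2 = ‖a‖ ^ 2 + ‖b‖ ^ 2 + ‖c‖ ^ 2 := by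
  have h := inner_tripleVec_tripleVec hd M a b c a b c
  simp only [Complex.star_def, Complex.conj_mul'] at h
  rw [inner_self_eq_ofReal] at h
  exact_mod_cast h

/-- For every orthonormal basis there are three states, each orthogonal to one of three basis
vectors and in their span, that have overlap `1 / 2` with a common unit vector at which the
gradients of the overlaps are linearly independent. -/
theorem exists_triple (hd : 3 ≤ d) (M : OrthonormalBasis (Fin d) ℂ (Hilb d)) :
    ∃ (χ : Fin 3 → State d) (f : Fin d → Fin 3) (v : Hilb d), ‖v‖ = 1 ∧
      (∀ k, inner ℂ (M k) (χ (f k) : Hilb d) = 0) ∧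
      (∀ i, vecOverlap (χ i : Hilb d) v = 1 / 2) ∧
      ∀ w : Fin 3 → ℝ, ∑ i, (w i : ℂ) •
        (inner ℂ (χ i : Hilb d) v • (χ i : Hilb d) - (vecOverlap (χ i : Hilb d) v : ℂ) • v) = 0 →
          w = 0 := by
  obtain ⟨r, hr0, hr⟩ : ∃ r : ℝ, 0 < r ∧ r ^ 2 = 1 / 2 :=
    ⟨√(1 / 2), by positivity, Real.sq_sqrt (by norm_num)⟩
  obtain ⟨q, hq0, hq⟩ : ∃ q : ℝ, 0 < q ∧ q ^ 2 = 1 / 3 :=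
    ⟨√(1 / 3), by positivity, Real.sq_sqrt (by norm_num)⟩
  -- As `q = 1 / √3`, this is `exp (i π / 6)` and `ζ'` is its conjugate. Equal phases would give
  -- overlap `2/3` with `v = q (1, 1, 1)`; the relative phase `π / 3` lowers it to `1/2`.
  set ζ : ℂ := ⟨3 / 2 * q, 1 / 2⟩ with hζ
  set ζ' : ℂ := ⟨3 / 2 * q, -(1 / 2)⟩ with hζ'
  have hsζ : star ζ = ζ' := rfl
  have hsζ' : star ζ' = ζ := by rw [← hsζ, star_star]
  have hadd : ζ + ζ' = ((3 * q : ℝ) : ℂ) := by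
    apply Complex.ext
    · simp [hζ, hζ']; ring
    · simp [hζ, hζ']
  have hnζ : ‖ζ‖ ^ 2 = 1 := by
    rw [Complex.sq_norm, Complex.normSq_apply]
    simp only [hζ]
    linear_combination 9 / 4 * hq
  have hnζ' : ‖ζ'‖ ^ 2 = 1 := by rw [← hsζ, norm_star, hnζ]
  set T := tripleVec hd M
  have hstate : ∀ a b c : ℂ, ‖a‖ ^ 2 + ‖b‖ ^ 2 + ‖c‖ ^ 2 = 2 →
      (r : ℂ) • T a b c ∈ sphere (0 : Hilb d) 1 := by
    intro a b c h
    rw [mem_sphere_zero_iff_norm]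
    refine (pow_eq_one_iff_of_nonneg (norm_nonneg _) two_ne_zero).1 ?_
    rw [norm_smul, mul_pow, norm_sq_tripleVec, h, Complex.norm_real, Real.norm_eq_abs, sq_abs, hr]
    norm_num
  let χ₀ : State d := ⟨(r : ℂ) • T 0 ζ ζ', hstate _ _ _ (by simp [hnζ, hnζ']; norm_num)⟩
  let χ₁ : State d := ⟨(r : ℂ) • T ζ' 0 ζ, hstate _ _ _ (by simp [hnζ, hnζ']; norm_num)⟩
  -- The phases break the cyclic pattern of `χ₀` and `χ₁` on purpose: with `T ζ ζ' 0` the three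
  -- gradients would sum to zero.
  let χ₂ : State d := ⟨(r : ℂ) • T ζ' ζ 0, hstate _ _ _ (by simp [hnζ, hnζ']; norm_num)⟩
  have hrq : (r : ℂ) * ((q : ℂ) * (ζ + ζ')) = r := by
    rw [hadd]
    norm_cast
    linear_combination 3 * r * hq
  have hi : ∀ χ ∈ ({χ₀, χ₁, χ₂} : Set (State d)),
      inner ℂ (χ : Hilb d) ((q : ℂ) • T 1 1 1) = (r : ℂ) := by
    rintro χ (rfl | rfl | rfl)
    all_goals
      simp only [χ₀, χ₁, χ₂]
      rw [inner_smul_left, inner_smul_right, inner_tripleVec_tripleVec, Complex.conj_ofReal]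
      simp only [star_zero, hsζ, hsζ']
      linear_combination hrq
  have hvn : ‖(q : ℂ) • T 1 1 1‖ = 1 := by
    refine (pow_eq_one_iff_of_nonneg (norm_nonneg _) two_ne_zero).1 ?_
    rw [norm_smul, mul_pow, norm_sq_tripleVec, Complex.norm_real, Real.norm_eq_abs, sq_abs, hq]
    norm_num
  have ho : ∀ χ ∈ ({χ₀, χ₁, χ₂} : Set (State d)),
      vecOverlap (χ : Hilb d) ((q : ℂ) • T 1 1 1) = 1 / 2 := by
    intro χ hχ
    rw [vecOverlap, hi χ hχ, hvn, Complex.norm_real, Real.norm_eq_abs, sq_abs, hr]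
    norm_num
  have m₀ : χ₀ ∈ ({χ₀, χ₁, χ₂} : Set (State d)) := by simp
  have m₁ : χ₁ ∈ ({χ₀, χ₁, χ₂} : Set (State d)) := by simp
  have m₂ : χ₂ ∈ ({χ₀, χ₁, χ₂} : Set (State d)) := by simp
  -- The basis vectors with index at least `3` are orthogonal to all three states, so they may be
  -- assigned to `χ₀`.
  refine ⟨![χ₀, χ₁, χ₂], fun k => if k.1 = 1 then 1 else if k.1 = 2 then 2 else 0,
    (q : ℂ) • T 1 1 1, hvn, ?_, ?_, ?_⟩
  · intro k
    by_cases h1 : k.1 = 1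
    · simp [h1, χ₁, T, inner_tripleVec]
    by_cases h2 : k.1 = 2
    · simp [h2, χ₂, T, inner_tripleVec]
    · simp [h1, h2, χ₀, T, inner_tripleVec]
  · intro i
    fin_cases i
    · exact ho _ m₀
    · exact ho _ m₁
    · exact ho _ m₂
  · intro w hw
    rw [Fin.sum_univ_three] at hw
    simp only [Matrix.cons_val_zero, Matrix.cons_val_one, Matrix.cons_val,
      hi _ m₀, hi _ m₁, hi _ m₂, ho _ m₀, ho _ m₁, ho _ m₂] at hw
    have hrr : (r : ℂ) * r = 1 / 2 := by
      have : r * r = 1 / 2 := by rw [← hr]; ring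
      rw [← Complex.ofReal_mul, this]
      norm_num
    have hcomp := fun k => congrArg (inner ℂ (M k)) hw
    have e0 := hcomp ⟨0, by omega⟩
    have e1 := hcomp ⟨1, by omega⟩
    have e2 := hcomp ⟨2, by omega⟩
    simp only [χ₀, χ₁, χ₂, T, inner_add_right, inner_sub_right, inner_smul_right, inner_tripleVec,
      inner_zero_right, if_true, if_false, one_ne_zero, OfNat.ofNat_ne_zero, OfNat.ofNat_ne_one,
      mul_zero, mul_one, zero_sub] at e0 e1 e2
    push_cast at e0 e1 e2
    have c0 : (w 1 : ℂ) * ζ' + w 2 * ζ' - q * (w 0 + w 1 + w 2) = 0 := by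
      linear_combination 2 * e0 - 2 * (w 1 * ζ' + w 2 * ζ') * hrr
    have c1 : (w 0 : ℂ) * ζ + w 2 * ζ - q * (w 0 + w 1 + w 2) = 0 := by
      linear_combination 2 * e1 - 2 * (w 0 * ζ + w 2 * ζ) * hrr
    have c2 : (w 0 : ℂ) * ζ' + w 1 * ζ - q * (w 0 + w 1 + w 2) = 0 := by
      linear_combination 2 * e2 - 2 * (w 0 * ζ' + w 1 * ζ) * hrr
    have r0 := congrArg Complex.re c0
    have i0 := congrArg Complex.im c0
    have i1 := congrArg Complex.im c1
    have i2 := congrArg Complex.im c2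
    simp [hζ, hζ'] at r0 i0 i1 i2
    -- The imaginary parts alone leave the solution `(1, 1, -1)` up to scale. A real part excludes
    -- it by forcing the sum of the coefficients to vanish.
    have hW : q * (w 0 + w 1 + w 2) = 0 := by linear_combination -r0 - 3 * q * i0
    have hW' := (mul_eq_zero.1 hW).resolve_left hq0.ne'
    funext i
    fin_cases i
    · simp; linarith
    · simp; linarith
    · simp; linarith

end Triple

/-! ### The contradiction. -/

theorem not_isSymmetric_and_isMaximallyNontrivial (hd : 3 ≤ d) {T : OntologicalTheory d (CP d)}
    (hT : T.IsSymmetric) (hm : T.IsMaximallyNontrivial) : False := by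
  let M : OrthonormalBasis (Fin d) ℂ (Hilb d) := EuclideanSpace.basisFun (Fin d) ℂ
  obtain ⟨χ, f, v, hv, horth, hov, hind⟩ := exists_triple hd M
  choose N S hS using fun i => T.exists_isRegularPartAt (χ i)
  refine coneMeasure_iInter_overlap_ne_zero hv hind (fun i => (hS i).measurableSet)
    (fun i ε hε => ?_)
    (OntologicalTheory.coneMeasure_iInter_eq_zero_of_orthogonal (by omega) hT hS M f horth)
  rw [hov i]
  exact OntologicalTheory.volume_inter_ball_half_ne_zero hd hT hm (hS i) hε

end PsiEpistemic

theorem mainTheorem3 (d : ℕ) (hd : 3 ≤ d) :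
    ¬ ∃ T : PsiEpistemic.OntologicalTheory d (PsiEpistemic.CP d),
        T.IsPsiEpistemic ∧ T.IsSymmetric ∧ T.IsMaximallyNontrivial := by
  rintro ⟨T, -, hT, hm⟩
  exact PsiEpistemic.not_isSymmetric_and_isMaximallyNontrivial hd hT hm
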